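/- **Setting.** A topological groupoid $\mathsf G$ has spaces $\mathsf G_0,\mathsf G_1$ of objects and arrows and continuous structure maps; $a\cdot b$ is defined when $t(a)=s(b)$. A morphism $\Psi:\mathsf H\to\mathsf G$ (a pair of continuous maps commuting with the structure maps) is *Morita* if $$\mathsf H_1\cong(\mathsf H_0\times\mathsf H_0)\times_{\mathsf G_0\times\mathsf G_0}\mathsf G_1$$ via $(s,t)$ and $\Psi_1$ (the square is cartesian in topological spaces) and $s\circ\pi_2:\mathsf H_0\,{}_{\Psi_0}\!\times_t\mathsf G_1\to\mathsf G_0$ is an open surjection. $\mathsf G$ and $\mathsf H$ are *Morita equivalent* if there are a topological groupoid $\mathsf K$ and Morita morphisms $\mathsf G\leftarrow\mathsf K\to\mathsf H$. The *inertia groupoid* $\wedge\mathsf G$ has as objects the $v\in\mathsf G_1$ with $s(v)=t(v)$, and as arrows $v\to w$ the $\alpha\in\mathsf G_1$ with $v\cdot\alpha=\alpha\cdot w$ (subspace topologies). An *orbifold chart* $(V,G,\pi)$ of a space $X$ is a connected smooth $n$-manifold $V$ with a smooth effective action of a finite group $G$ and a map $\pi:V\to X$ inducing a homeomorphism of $V/G$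 onto an open subset of $X$. An *embedding* $(\lambda,\varphi):(W,H,\rho)\to(V,G,\pi)$ is a smooth open embedding $\lambda:W\to V$ with $\pi\lambda=\rho$, equivariant along a monomorphism $\varphi:H\to G$. An ($n$-dimensional, effective) *orbifold structure* on a paracompact Hausdorff space $X$ is a family of charts $(V_p,G_p,\pi_p)_{p\in X}$ with $p\in\pi_p(V_p)$ such that, whenever $q\in\pi_p(V_p)$, some chart whose image contains $q$ embeds into both $V_p$ and $V_q$. The groupoid $\mathsf X$ associated with the orbifold has $\mathsf X_0=\bigsqcup_p V_p$; its arrows from $x\in V_p$ to $y\in V_q$ are classes $[\lambda_1,w,\lambda_2]$, where $\lambda_1:W\to V_p$ and $\lambda_2:W\to V_q$ are embeddings of a chart $W$, $w\in W$, $\lambda_1(w)=x$, $\lambda_2(w)=y$, for the equivalence relation generated by $(\lambda_1\nu,w',\lambda_2\nu)\sim(\lambda_1,\nu(w'),\lambda_2)$ with $\nu:W'\to W$ an embedding; $\mathsf X_1$ has the quotient topology from the disjoint union of the $W$'s. Further, $[\lambda_1,w,\lambda_2]\cdot[\mu_1,z,\mu_2]=[\lambda_1\nu,y,\mu_2\mu]$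 if $\nu,\mu$ are embeddings with $\lambda_2\nu=\mu_1\mu$, $\nu(y)=w$, $\mu(y)=z$. Fix a representative $g$ of each conjugacy class $(g)\subset G_p$, for every $p$. The *twisted-sector groupoid* $\widetilde{\Sigma_1X}$ has as objects $\bigsqcup_p\bigsqcup_{(g)\subset G_p}V_p^g\times\{g\}$; its arrows from $(x,g)$, $x\in V_p^g$, to $(y,h)$, $y\in V_q^h$, are classes $[\lambda_1,w,\lambda_2]$ of triples as above for which there is $k\in H$ (where $H$ is the group of $W$) with $\varphi_1(k)=g$, $\varphi_2(k)=h$ and $w\in W^k$, modulo refinement by embeddings $\nu:W'\to W$ respecting the elements $k',k$ and points of $W'^{k'}$; the topology and the composition are as for $\mathsf X$, with $W^k$ in place of $W$. **Proposition.** Let $X$ be an orbifold with associated groupoid $\mathsf X$, and let representatives of the conjugacy classes be chosen arbitrarily. 1. The inertia groupoid $\wedge\mathsf X$ is Morita equivalent to $\widetilde{\Sigma_1X}$. 2. $\widetilde{\Sigma_1X}$ is a subgroupoid of $\wedge\mathsf X$, and there are morphisms $$\widetilde{\Sigma_1X}\overset{\iota}{\hookrightarrow}\wedge\mathsf X\overset{M}{\longrightarrow}\widetilde{\Sigma_1X}$$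 of topological groupoids in which $M$ is Morita and $\iota$ is a topological embedding on objects and on arrows, given by $(x,g)\mapsto[\mathrm{id},x,\lambda_g]$ on objects, where $\lambda_g(y)=gy$, and by $[\lambda_1,w,\lambda_2]\mapsto[\lambda_1,w,\lambda_2]$ on arrows. 3. For every $p\in X$, $\widetilde{\Sigma_1X}$ restricted to the objects over $p$ is $\bigsqcup_{(g)\subset G_p}\big(V_p^g\times C_{G_p}(g)\rightrightarrows V_p^g\big)$: the map $(x,z)\mapsto[\mathrm{id},x,\lambda_z]$ is an open embedding of $\bigsqcup_{(g)}V_p^g\times C_{G_p}(g)$ into the space of arrows, whose image is the set of all arrows with source and target over $p$. -/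

import Mathlib

open CategoryTheory Topology Manifold ContDiff

universe u v w w₁

/-! ## Topological groupoids

Composition is written in diagrammatic order: `G.comp a b` is defined when the target of `a`
is the source of `b`. -/

/-- A topological groupoid (a small category with all arrows invertible, with topologies on objects
and arrows for which all structure maps are continuous). -/
structure TopGroupoid where
  Obj : Type u
  Arr : Type v
  [topObj : TopologicalSpace Obj]
  [topArr : TopologicalSpace Arr]
  src : Arr → Obj
  tgt : Arr → Obj
  one : Obj → Arr
  inv : Arr → Arr
  comp : ∀ a b : Arr, tgt a = src b → Arr
  src_one : ∀ x, src (one x) = x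
  tgt_one : ∀ x, tgt (one x) = x
  src_inv : ∀ a, src (inv a) = tgt a
  tgt_inv : ∀ a, tgt (inv a) = src a
  src_comp : ∀ a b h, src (comp a b h) = src a
  tgt_comp : ∀ a b h, tgt (comp a b h) = tgt b
  one_comp : ∀ a, comp (one (src a)) a (tgt_one _) = a
  comp_one : ∀ a, comp a (one (tgt a)) (src_one _).symm = a
  assoc : ∀ a b c (h : tgt a = src b) (h' : tgt b = src c),
    comp (comp a b h) c ((tgt_comp a b h).trans h') =
      comp a (comp b c h') (h.trans (src_comp b c h').symm)
  comp_inv : ∀ a, comp a (inv a) (src_inv a).symm = one (src a)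
  inv_comp : ∀ a, comp (inv a) a (tgt_inv a) = one (tgt a)
  continuous_src : Continuous src
  continuous_tgt : Continuous tgt
  continuous_one : Continuous one
  continuous_inv : Continuous inv
  continuous_comp :
    Continuous fun p : {p : Arr × Arr // tgt p.1 = src p.2} => comp p.1.1 p.1.2 p.2

namespace TopGroupoid

attribute [instance] topObj topArr

/-- A morphism of topological groupoids: a pair of continuous maps commuting with the structure
maps. -/
structure Hom (G : TopGroupoid.{u, v}) (H : TopGroupoid.{w, w₁}) where
  obj : G.Obj → H.Obj
  arr : G.Arr → H.Arr
  continuous_obj : Continuous obj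
  continuous_arr : Continuous arr
  src_arr : ∀ a, H.src (arr a) = obj (G.src a)
  tgt_arr : ∀ a, H.tgt (arr a) = obj (G.tgt a)
  arr_one : ∀ x, arr (G.one x) = H.one (obj x)
  arr_inv : ∀ a, arr (G.inv a) = H.inv (arr a)
  arr_comp : ∀ a b (h : G.tgt a = G.src b), arr (G.comp a b h) =
    H.comp (arr a) (arr b) ((tgt_arr a).trans ((congrArg obj h).trans (src_arr b).symm))

/-- A Morita morphism: the square formed by the arrow map, the anchor maps and the object map
is cartesian (in topological spaces), and `s ∘ π₂ : G₀ ×_{H₀} H₁ → H₀` is an open surjection. -/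
structure Hom.IsMorita {G : TopGroupoid.{u, v}} {H : TopGroupoid.{w, w₁}} (Φ : Hom G H) :
    Prop where
  cartesian : IsHomeomorph fun a : G.Arr =>
    (⟨((G.src a, G.tgt a), Φ.arr a), (Φ.src_arr a).symm, (Φ.tgt_arr a).symm⟩ :
      {p : (G.Obj × G.Obj) × H.Arr //
        Φ.obj p.1.1 = H.src p.2 ∧ Φ.obj p.1.2 = H.tgt p.2})
  isOpenMap : IsOpenMap fun p : {p : G.Obj × H.Arr // Φ.obj p.1 = H.tgt p.2} => H.src p.1.2
  surjective : Function.Surjective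
    fun p : {p : G.Obj × H.Arr // Φ.obj p.1 = H.tgt p.2} => H.src p.1.2

/-- Morita equivalence: a third topological groupoid with Morita morphisms to both. -/
def MoritaEquivalent (G : TopGroupoid.{u, v}) (H : TopGroupoid.{w, w₁}) : Prop :=
  ∃ (K : TopGroupoid.{max u w, max v w₁}) (Φ : Hom K G) (Ψ : Hom K H),
    Φ.IsMorita ∧ Ψ.IsMorita

/-- A morphism exhibiting `G` as a (topological) subgroupoid of `H`. -/
structure Hom.IsSubgroupoidEmbedding {G : TopGroupoid.{u, v}} {H : TopGroupoid.{w, w₁}}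
    (Φ : Hom G H) : Prop where
  obj : IsEmbedding Φ.obj
  arr : IsEmbedding Φ.arr

/-- Objects of the inertia groupoid: the loops of `G`. -/
abbrev Loop (G : TopGroupoid.{u, v}) : Type v := {a : G.Arr // G.src a = G.tgt a}

/-- Arrows `v ⟶ w` of the inertia groupoid: `α ∈ G₁` with `v · α = α · w`. -/
abbrev LoopArr (G : TopGroupoid.{u, v}) : Type v :=
  {p : G.Loop × G.Arr × G.Loop // ∃ (h : G.tgt p.1.1 = G.src p.2.1)
    (h' : G.tgt p.2.1 = G.src p.2.2.1), G.comp p.1.1 p.2.1 h = G.comp p.2.1 p.2.2.1 h'}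

section inertia

variable (G : TopGroupoid.{u, v})

theorem comp_congr {a a' b b' : G.Arr} (ha : a = a') (hb : b = b') (h : G.tgt a = G.src b) :
    G.comp a b h = G.comp a' b' (by rw [← ha, ← hb]; exact h) := by
  subst ha hb; rfl

theorem continuous_comp' {T : Type*} [TopologicalSpace T] {f g : T → G.Arr}
    (hf : Continuous f) (hg : Continuous g) (h : ∀ t, G.tgt (f t) = G.src (g t)) :
    Continuous fun t => G.comp (f t) (g t) (h t) :=
  G.continuous_comp.comp
    (Continuous.subtype_mk (hf.prodMk hg) h : Continuous fun t => (⟨(f t, g t), h t⟩ :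
      {p : G.Arr × G.Arr // G.tgt p.1 = G.src p.2}))

/-- The inertia groupoid `∧G`. -/
def inertia : TopGroupoid.{v, v} where
  Obj := G.Loop
  Arr := G.LoopArr
  src p := p.1.1
  tgt p := p.1.2.2
  one v := ⟨(v, G.one (G.src v.1), v), by
    refine ⟨by rw [G.src_one, v.2], G.tgt_one _, ?_⟩
    rw [G.one_comp, G.comp_congr rfl (congrArg G.one v.2)]
    exact G.comp_one v.1⟩
  inv p := ⟨(p.1.2.2, G.inv p.1.2.1, p.1.1), by
    obtain ⟨⟨v, α, w⟩, h, h', e⟩ := p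
    dsimp only at h h' e ⊢
    have h1 : G.tgt w.1 = G.src (G.inv α) := by rw [G.src_inv, h', w.2]
    have h2 : G.tgt (G.inv α) = G.src v.1 := by rw [G.tgt_inv, v.2, h]
    refine ⟨h1, h2, ?_⟩
    have h3 : G.tgt (G.inv α) = G.src α := G.tgt_inv α
    have e1 : G.comp (G.inv α) (G.comp α w.1 h') (by rw [G.src_comp, h3]) = w.1 := by
      rw [← G.assoc _ _ _ h3 h']
      rw [G.comp_congr (G.inv_comp α) rfl]
      rw [G.comp_congr (congrArg G.one h') rfl]
      exact G.one_comp _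
    have e2 : G.comp (G.comp (G.inv α) v.1 h2) α (by rw [G.tgt_comp, h]) = w.1 := by
      rw [G.assoc _ _ _ h2 h, G.comp_congr rfl e, e1]
    have e3 : G.comp (G.comp (G.comp (G.inv α) v.1 h2) α (by rw [G.tgt_comp, h])) (G.inv α)
        (by rw [G.tgt_comp, G.src_inv]) = G.comp (G.inv α) v.1 h2 := by
      rw [G.assoc _ _ _ (by rw [G.tgt_comp, h]) (G.src_inv α).symm,
        G.comp_congr rfl (G.comp_inv α),
        G.comp_congr rfl (congrArg G.one (h.symm.trans (G.tgt_comp _ _ h2).symm))]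
      exact G.comp_one _
    rw [← e3]
    exact (G.comp_congr e2 rfl _).symm⟩
  comp p q hpq := ⟨(p.1.1, G.comp p.1.2.1 q.1.2.1 (by
      obtain ⟨h, h', e⟩ := p.2
      obtain ⟨k, k', e'⟩ := q.2
      rw [h', hpq, q.1.1.2, k]), q.1.2.2), by
    obtain ⟨⟨v, α, w⟩, h, h', e⟩ := p
    obtain ⟨⟨w', β, x⟩, k, k', e'⟩ := q
    dsimp only at hpq
    subst hpq
    dsimp only at h h' e k k' e' ⊢
    refine ⟨by rw [G.src_comp, h], by rw [G.tgt_comp, k'], ?_⟩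
    have hab : G.tgt α = G.src β := by rw [h', w.2, k]
    rw [← G.assoc _ _ _ h hab, G.comp_congr e rfl, G.assoc _ _ _ h' k, G.comp_congr rfl e',
      G.assoc _ _ _ hab k']⟩
  src_one _ := rfl
  tgt_one _ := rfl
  src_inv _ := rfl
  tgt_inv _ := rfl
  src_comp _ _ _ := rfl
  tgt_comp _ _ _ := rfl
  one_comp p := by
    obtain ⟨⟨v, α, w⟩, h, h', e⟩ := p
    refine Subtype.ext (Prod.ext rfl (Prod.ext ?_ rfl))
    dsimp only at h ⊢
    rw [G.comp_congr (congrArg G.one (v.2.trans h)) rfl]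
    exact G.one_comp α
  comp_one p := by
    obtain ⟨⟨v, α, w⟩, h, h', e⟩ := p
    refine Subtype.ext (Prod.ext rfl (Prod.ext ?_ rfl))
    dsimp only at h' ⊢
    rw [G.comp_congr rfl (congrArg G.one h'.symm)]
    exact G.comp_one α
  assoc p q r h h' := Subtype.ext (Prod.ext rfl (Prod.ext (G.assoc _ _ _ _ _) rfl))
  comp_inv p := by
    obtain ⟨⟨v, α, w⟩, h, h', e⟩ := p
    refine Subtype.ext (Prod.ext rfl (Prod.ext ?_ rfl))
    dsimp only at h ⊢
    rw [G.comp_inv, v.2, h]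
  inv_comp p := by
    obtain ⟨⟨v, α, w⟩, h, h', e⟩ := p
    refine Subtype.ext (Prod.ext rfl (Prod.ext ?_ rfl))
    dsimp only at h' ⊢
    rw [G.inv_comp, h']
  continuous_src := by fun_prop
  continuous_tgt := by fun_prop
  continuous_one := by
    have := G.continuous_src
    have := G.continuous_one
    exact Continuous.subtype_mk (by fun_prop) _
  continuous_inv := by
    have := G.continuous_inv
    exact Continuous.subtype_mk (by fun_prop) _
  continuous_comp := by
    refine Continuous.subtype_mk (Continuous.prodMk (by fun_prop) (Continuous.prodMk ?_
      (by fun_prop))) _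
    exact G.continuous_comp' (by fun_prop) (by fun_prop) _

end inertia

end TopGroupoid

/-! ## The groupoid of spans of chart embeddings -/

/-- A category of charts: every chart has a space of points, every arrow induces an open embedding
of spaces, every arrow is a monomorphism, and two arrows into the same chart that meet in a point
have a common refinement through that point. -/
class ChartCat (C : Type w) [Category.{w₁} C] where
  Pt : C → Type u
  [top : ∀ A, TopologicalSpace (Pt A)]
  map : ∀ {A B : C}, (A ⟶ B) → Pt A → Pt B
  map_id : ∀ {A : C} (x : Pt A), map (𝟙 A) x = x
  map_comp : ∀ {A B D : C} (f : A ⟶ B) (g : B ⟶ D) (x : Pt A), map (f ≫ g) x = map g (map f x)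
  isOpenEmbedding_map : ∀ {A B : C} (f : A ⟶ B), IsOpenEmbedding (map f)
  mono : ∀ {A B : C} (f : A ⟶ B), Mono f
  refine : ∀ {A B D : C} (f : A ⟶ D) (g : B ⟶ D) (a : Pt A) (b : Pt B), map f a = map g b →
    ∃ (R : C) (r : Pt R) (f' : R ⟶ A) (g' : R ⟶ B),
      map f' r = a ∧ map g' r = b ∧ f' ≫ f = g' ≫ g

attribute [reducible, instance] ChartCat.top

namespace ChartCat

variable {C : Type w} [Category.{w₁} C] [ChartCat.{u} C] {I : Type v}

/-- A span `V i ⟵ A ⟶ V j` of embeddings of charts. -/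
structure Span (V : I → C) where
  i : I
  j : I
  apex : C
  left : apex ⟶ V i
  right : apex ⟶ V j

/-- A triple `(λ₁, a, λ₂)`: a span together with a point of its apex. The set of all triples
carries the topology of the disjoint union of the apices. -/
abbrev Triple (V : I → C) := Σ S : Span V, Pt.{u} S.apex

variable {V : I → C}

/-- The triple `(νλ₁, b, νλ₂)` refines the triple `(λ₁, ν(b), λ₂)`. -/
inductive Refines : Triple V → Triple V → Prop
  | mk (i j : I) (A B : C) (l : A ⟶ V i) (r : A ⟶ V j) (ν : B ⟶ A) (l' : B ⟶ V i) (r' : B ⟶ V j)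
      (b : Pt.{u} B) (a : Pt.{u} A) (h : map ν b = a) (hl : ν ≫ l = l') (hr : ν ≫ r = r') :
      Refines ⟨⟨i, j, B, l', r'⟩, b⟩ ⟨⟨i, j, A, l, r⟩, a⟩

variable (V) in
/-- Equivalence classes `[λ₁, a, λ₂]` of triples, for the equivalence relation generated by
refinement, with the quotient topology. -/
abbrev SpanArr := Quot (Refines (V := V))

theorem Refines.refl (S : Triple V) : Refines S S := by
  obtain ⟨⟨i, j, A, l, r⟩, a⟩ := S
  exact Refines.mk i j A A l r (𝟙 A) _ _ a a (map_id a) (Category.id_comp _) (Category.id_comp _)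

theorem Refines.trans {S T U : Triple V} (h : Refines S T) (h' : Refines T U) : Refines S U := by
  cases h' with
  | mk i j A B l r ν l' r' b a e hl hr =>
    cases h with
    | mk _ _ _ D _ _ μ l'' r'' d _ e' hl' hr' =>
      exact Refines.mk i j A D l r (μ ≫ ν) _ _ d a (by rw [map_comp, e', e])
        (by rw [Category.assoc, hl, hl']) (by rw [Category.assoc, hr, hr'])

theorem Refines.ore {S T U : Triple V} (h : Refines S U) (h' : Refines T U) :
    ∃ W, Refines W S ∧ Refines W T := by
  cases h with
  | mk i j A B l r ν l₁ r₁ b a e hl hr =>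
    cases h' with
    | mk _ _ _ D _ _ μ l₂ r₂ d _ e' hl' hr' =>
      obtain ⟨R, x, f, g, hf, hg, sq⟩ := ChartCat.refine ν μ b d (e.trans e'.symm)
      refine ⟨⟨⟨i, j, R, f ≫ l₁, f ≫ r₁⟩, x⟩, Refines.mk _ _ _ _ _ _ _ _ _ _ _ hf rfl rfl,
        Refines.mk _ _ _ _ _ _ g _ _ _ _ hg ?_ ?_⟩
      · rw [← hl, ← hl', ← Category.assoc, ← Category.assoc, sq]
      · rw [← hr, ← hr', ← Category.assoc, ← Category.assoc, sq]

theorem mk_eq_iff {S T : Triple V} :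
    (Quot.mk _ S : SpanArr V) = Quot.mk _ T ↔ ∃ W, Refines W S ∧ Refines W T := by
  constructor
  · intro h
    rw [Quot.eq] at h
    induction h with
    | rel x y h => exact ⟨x, Refines.refl x, h⟩
    | refl x => exact ⟨x, Refines.refl x, Refines.refl x⟩
    | symm x y _ ih => exact ⟨ih.choose, ih.choose_spec.2, ih.choose_spec.1⟩
    | trans x y z _ _ ih ih' =>
      obtain ⟨W, h1, h2⟩ := ih
      obtain ⟨W', h1', h2'⟩ := ih'
      obtain ⟨Z, k1, k2⟩ := h2.ore h1'
      exact ⟨Z, k1.trans h1, k2.trans h2'⟩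
  · rintro ⟨W, h, h'⟩
    exact (Quot.sound h).symm.trans (Quot.sound h')

/-- Source of a triple. -/
def Triple.src (S : Triple V) : Σ i, Pt.{u} (V i) := ⟨S.1.i, map S.1.left S.2⟩
/-- Target of a triple. -/
def Triple.tgt (S : Triple V) : Σ i, Pt.{u} (V i) := ⟨S.1.j, map S.1.right S.2⟩
/-- The triple `(λ₂, a, λ₁)`. -/
def Triple.swap (S : Triple V) : Triple V := ⟨⟨S.1.j, S.1.i, S.1.apex, S.1.right, S.1.left⟩, S.2⟩
/-- The triple `(id, x, id)`. -/
def Triple.one (x : Σ i, Pt.{u} (V i)) : Triple V := ⟨⟨x.1, x.1, V x.1, 𝟙 _, 𝟙 _⟩, x.2⟩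

theorem Refines.src_eq {S T : Triple V} (h : Refines S T) : S.src = T.src := by
  cases h with
  | mk i j A B l r ν l' r' b a e hl hr => simp [Triple.src, map_comp, e, ← hl]

theorem Refines.tgt_eq {S T : Triple V} (h : Refines S T) : S.tgt = T.tgt := by
  cases h with
  | mk i j A B l r ν l' r' b a e hl hr => simp [Triple.tgt, map_comp, e, ← hr]

theorem Refines.swap {S T : Triple V} (h : Refines S T) : Refines S.swap T.swap := by
  cases h with
  | mk i j A B l r ν l' r' b a e hl hr => exact Refines.mk _ _ _ _ _ _ _ _ _ _ _ e hr hl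

/-- `[λ₁ν, d, μ₂μ]` is the composite of `[λ₁, a, λ₂]` and `[μ₁, b, μ₂]` whenever
`ν(d) = a`, `μ(d) = b` and `λ₂ν = μ₁μ`. -/
inductive Composite : Triple V → Triple V → Triple V → Prop
  | mk (i j k : I) (A B D : C) (l : A ⟶ V i) (r : A ⟶ V j) (m : B ⟶ V j) (n : B ⟶ V k)
      (ν : D ⟶ A) (μ : D ⟶ B) (a : Pt.{u} A) (b : Pt.{u} B) (d : Pt.{u} D)
      (ha : map ν d = a) (hb : map μ d = b) (sq : ν ≫ r = μ ≫ m) :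
      Composite ⟨⟨i, j, A, l, r⟩, a⟩ ⟨⟨j, k, B, m, n⟩, b⟩ ⟨⟨i, k, D, ν ≫ l, μ ≫ n⟩, d⟩

theorem Composite.exists {S T : Triple V} (h : S.tgt = T.src) : ∃ R, Composite S T R := by
  obtain ⟨⟨i, j, A, l, r⟩, a⟩ := S
  obtain ⟨⟨j', k, B, m, n⟩, b⟩ := T
  obtain ⟨h1, h2⟩ := Sigma.mk.inj_iff.1 h
  dsimp only at h1
  subst h1
  obtain ⟨D, d, ν, μ, ha, hb, sq⟩ := ChartCat.refine r m a b (eq_of_heq h2)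
  exact ⟨_, Composite.mk i j k A B D l r m n ν μ a b d ha hb sq⟩

theorem Composite.tgt_eq_src {S T R : Triple V} (h : Composite S T R) : S.tgt = T.src := by
  cases h with
  | mk i j k A B D l r m n ν μ a b d ha hb sq =>
    simp only [Triple.tgt, Triple.src, ← ha, ← hb, ← map_comp, sq]

theorem Composite.src_eq {S T R : Triple V} (h : Composite S T R) : R.src = S.src := by
  cases h with
  | mk i j k A B D l r m n ν μ a b d ha hb sq => simp [Triple.src, map_comp, ha]

theorem Composite.tgt_eq {S T R : Triple V} (h : Composite S T R) : R.tgt = T.tgt := by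
  cases h with
  | mk i j k A B D l r m n ν μ a b d ha hb sq => simp [Triple.tgt, map_comp, hb]

theorem Composite.unique {S T R R' : Triple V} (h : Composite S T R) (h' : Composite S T R') :
    (Quot.mk _ R : SpanArr V) = Quot.mk _ R' := by
  cases h with
  | mk i j k A B D l r m n ν μ a b d ha hb sq =>
    cases h' with
    | mk _ _ _ _ _ D' _ _ _ _ ν' μ' _ _ d' ha' hb' sq' =>
      obtain ⟨E, e, σ, τ, hσ, hτ, w⟩ := ChartCat.refine ν ν' d d' (ha.trans ha'.symm)
      have w' : σ ≫ μ = τ ≫ μ' := by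
        have := ChartCat.mono m
        rw [← cancel_mono m, Category.assoc, Category.assoc, ← sq, ← sq', ← Category.assoc, w,
          Category.assoc]
      rw [mk_eq_iff]
      refine ⟨⟨⟨i, k, E, σ ≫ ν ≫ l, σ ≫ μ ≫ n⟩, e⟩,
        Refines.mk _ _ _ _ _ _ _ _ _ _ _ hσ rfl rfl, Refines.mk _ _ _ _ _ _ τ _ _ _ _ hτ ?_ ?_⟩
      · rw [← Category.assoc, ← w, Category.assoc]
      · rw [← Category.assoc, ← w', Category.assoc]

theorem Composite.of_refines_left {S S' T R : Triple V} (h : Refines S' S)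
    (h' : Composite S' T R) : Composite S T R := by
  cases h with
  | mk i j A B l r κ l₁ r₁ b a e hl hr =>
    subst hl hr
    generalize hQ : (⟨⟨i, j, B, κ ≫ l, κ ≫ r⟩, b⟩ : Triple V) = Q at h'
    cases h' with
    | mk i' j' k A' B' D l' r' m n ν μ a' b' d ha hb sq =>
      cases hQ
      rw [← Category.assoc]
      exact Composite.mk _ _ _ _ _ _ _ _ _ _ _ _ _ _ _ (by rw [map_comp, ha, e]) hb
        (by rw [Category.assoc, sq])

theorem Composite.of_refines_right {S T T' R : Triple V} (h : Refines T' T)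
    (h' : Composite S T' R) : Composite S T R := by
  cases h with
  | mk i j A B l r κ l₁ r₁ b a e hl hr =>
    subst hl hr
    generalize hQ : (⟨⟨i, j, B, κ ≫ l, κ ≫ r⟩, b⟩ : Triple V) = Q at h'
    cases h' with
    | mk i' j' k A' B' D l' r' m n ν μ a' b' d ha hb sq =>
      cases hQ
      rw [← Category.assoc μ κ r]
      exact Composite.mk _ _ _ _ _ _ _ _ _ _ _ _ _ _ _ ha (by rw [map_comp, hb, e])
        (by rw [Category.assoc, sq])

theorem Composite.well_defined {S S' T T' R R' : Triple V}
    (hS : (Quot.mk _ S : SpanArr V) = Quot.mk _ S')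
    (hT : (Quot.mk _ T : SpanArr V) = Quot.mk _ T')
    (h : Composite S T R) (h' : Composite S' T' R') :
    (Quot.mk _ R : SpanArr V) = Quot.mk _ R' := by
  obtain ⟨S₂, h1, h2⟩ := mk_eq_iff.1 hS
  obtain ⟨T₂, k1, k2⟩ := mk_eq_iff.1 hT
  obtain ⟨Q, hQ⟩ := Composite.exists (S := S₂) (T := T₂)
    (by rw [h1.tgt_eq, k1.src_eq, h.tgt_eq_src])
  exact (h.unique ((hQ.of_refines_left h1).of_refines_right k1)).trans
    (((hQ.of_refines_left h2).of_refines_right k2).unique h')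

def SpanArr.src (a : SpanArr V) : Σ i, Pt.{u} (V i) :=
  Quot.lift Triple.src (fun _ _ h => h.src_eq) a

def SpanArr.tgt (a : SpanArr V) : Σ i, Pt.{u} (V i) :=
  Quot.lift Triple.tgt (fun _ _ h => h.tgt_eq) a

def SpanArr.inv (a : SpanArr V) : SpanArr V :=
  Quot.map Triple.swap (fun _ _ h => h.swap) a

theorem SpanArr.exists_composite (a b : SpanArr V) (h : a.tgt = b.src) :
    ∃ R S T : Triple V, Quot.mk _ S = a ∧ Quot.mk _ T = b ∧ Composite S T R := by
  induction a using Quot.ind with | _ S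
  induction b using Quot.ind with | _ T
  obtain ⟨R, hR⟩ := Composite.exists (S := S) (T := T) h
  exact ⟨R, S, T, rfl, rfl, hR⟩

noncomputable def SpanArr.comp (a b : SpanArr V) (h : a.tgt = b.src) : SpanArr V :=
  Quot.mk _ (SpanArr.exists_composite a b h).choose

theorem SpanArr.comp_mk {S T R : Triple V} (hR : Composite S T R)
    (h : SpanArr.tgt (Quot.mk _ S : SpanArr V) = SpanArr.src (Quot.mk _ T)) :
    SpanArr.comp (Quot.mk _ S) (Quot.mk _ T) h = Quot.mk _ R := by
  obtain ⟨S', T', h1, h2, h3⟩ := (SpanArr.exists_composite _ _ h).choose_spec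
  exact h3.well_defined h1 h2 hR

theorem isOpenMap_mk (S : Span V) :
    IsOpenMap fun x : Pt.{u} S.apex => (Quot.mk _ ⟨S, x⟩ : SpanArr V) := by
  intro U hU
  rw [← isQuotientMap_quot_mk.isOpen_preimage, isOpen_sigma_iff]
  intro T
  rw [isOpen_iff_forall_mem_open]
  rintro y ⟨x, hx, e⟩
  obtain ⟨W, h1, h2⟩ := mk_eq_iff.1 e
  obtain ⟨i, j, A, l, r⟩ := S
  obtain ⟨i', j', A', l', r'⟩ := T
  cases h1 with
  | mk _ _ _ B _ _ ν l₁ r₁ b _ hb hl hr =>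
    cases h2 with
    | mk _ _ _ _ _ _ μ _ _ _ _ hb' hl' hr' =>
      refine ⟨map μ '' (map ν ⁻¹' U), ?_,
        (isOpenEmbedding_map μ).isOpenMap _ (hU.preimage (isOpenEmbedding_map ν).continuous),
        ⟨b, by simpa [hb] using hx, hb'⟩⟩
      rintro _ ⟨c, hc, rfl⟩
      exact ⟨map ν c, hc, mk_eq_iff.2 ⟨⟨⟨i, j, B, l₁, r₁⟩, c⟩,
        Refines.mk _ _ _ _ _ _ _ _ _ _ _ rfl hl hr,
        Refines.mk _ _ _ _ _ _ _ _ _ _ _ rfl hl' hr'⟩⟩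

theorem continuous_mk (S : Span V) :
    Continuous fun x : Pt.{u} S.apex => (Quot.mk _ ⟨S, x⟩ : SpanArr V) :=
  continuous_quot_mk.comp continuous_sigmaMk

theorem SpanArr.continuous_src : Continuous (SpanArr.src : SpanArr V → _) :=
  continuous_quot_lift _ <| continuous_sigma fun S =>
    (continuous_sigmaMk (σ := fun i => Pt.{u} (V i))).comp (isOpenEmbedding_map S.left).continuous

theorem SpanArr.continuous_tgt : Continuous (SpanArr.tgt : SpanArr V → _) :=
  continuous_quot_lift _ <| continuous_sigma fun S =>
    (continuous_sigmaMk (σ := fun i => Pt.{u} (V i))).comp (isOpenEmbedding_map S.right).continuous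

theorem SpanArr.continuous_inv : Continuous (SpanArr.inv : SpanArr V → _) :=
  continuous_quot_lift _ <| continuous_sigma fun S =>
    continuous_mk ⟨S.j, S.i, S.apex, S.right, S.left⟩

theorem SpanArr.continuous_comp :
    Continuous fun p : {p : SpanArr V × SpanArr V // p.1.tgt = p.2.src} =>
      SpanArr.comp p.1.1 p.1.2 p.2 := by
  rw [continuous_iff_continuousAt]
  rintro ⟨⟨α, β⟩, h⟩
  dsimp only at h
  obtain ⟨R, S, T, rfl, rfl, hR⟩ := SpanArr.exists_composite α β h
  cases hR with
  | mk i j k A B D l r m n ν μ a b d ha hb sq =>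
    have hc : ∀ x : Pt.{u} D, Composite (V := V) ⟨⟨i, j, A, l, r⟩, map ν x⟩
        ⟨⟨j, k, B, m, n⟩, map μ x⟩ ⟨⟨i, k, D, ν ≫ l, μ ≫ n⟩, x⟩ := fun x =>
      Composite.mk _ _ _ _ _ _ _ _ _ _ _ _ _ _ _ rfl rfl sq
    let g : Pt.{u} D → {p : SpanArr V × SpanArr V // p.1.tgt = p.2.src} := fun x =>
      ⟨(Quot.mk _ ⟨⟨i, j, A, l, r⟩, map ν x⟩, Quot.mk _ ⟨⟨j, k, B, m, n⟩, map μ x⟩),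
        (hc x).tgt_eq_src⟩
    have hg : IsOpenMap g := by
      intro U hU
      have h1 := isOpenMap_mk (V := V) ⟨i, j, A, l, r⟩ _ ((isOpenEmbedding_map ν).isOpenMap U hU)
      have h2 := isOpenMap_mk (V := V) ⟨j, k, B, m, n⟩ _ ((isOpenEmbedding_map μ).isOpenMap U hU)
      convert (h1.prod h2).preimage continuous_subtype_val using 1
      ext ⟨⟨α, β⟩, hαβ⟩
      constructor
      · rintro ⟨x, hx, e⟩
        cases e
        exact ⟨⟨_, ⟨x, hx, rfl⟩, rfl⟩, ⟨_, ⟨x, hx, rfl⟩, rfl⟩⟩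
      · rintro ⟨⟨_, ⟨x, hx, rfl⟩, e1⟩, ⟨_, ⟨y, hy, rfl⟩, e2⟩⟩
        dsimp only at e1 e2 hαβ
        subst e1 e2
        have e3 : map r (map ν x) = map m (map μ y) := eq_of_heq (Sigma.mk.inj_iff.1 hαβ).2
        rw [← map_comp, ← map_comp, sq] at e3
        cases (isOpenEmbedding_map (μ ≫ m)).injective e3
        exact ⟨x, hx, rfl⟩
    have e0 : g d = ⟨(Quot.mk _ ⟨⟨i, j, A, l, r⟩, a⟩, Quot.mk _ ⟨⟨j, k, B, m, n⟩, b⟩), h⟩ := by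
      subst ha hb; rfl
    rw [← e0, ContinuousAt]
    refine (Filter.map_mono (hg.nhds_le d)).trans ?_
    rw [Filter.map_map]
    have e1 : (fun p : {p : SpanArr V × SpanArr V // p.1.tgt = p.2.src} =>
        SpanArr.comp p.1.1 p.1.2 p.2) ∘ g =
        fun x => (Quot.mk _ ⟨⟨i, k, D, ν ≫ l, μ ≫ n⟩, x⟩ : SpanArr V) :=
      funext fun x => SpanArr.comp_mk (hc x) (hc x).tgt_eq_src
    have e2 := (continuous_mk (V := V) ⟨i, k, D, ν ≫ l, μ ≫ n⟩).tendsto d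
    rw [← e1] at e2
    have e3 : SpanArr.comp (g d).1.1 (g d).1.2 (g d).2 =
        Quot.mk _ ⟨⟨i, k, D, ν ≫ l, μ ≫ n⟩, d⟩ := SpanArr.comp_mk (hc d) _
    change _ ≤ 𝓝 (SpanArr.comp (g d).1.1 (g d).1.2 (g d).2)
    rw [e3]
    exact e2

variable (V) in
/-- The groupoid of a family of charts `V i`, `i ∈ I`, in a category of charts: its objects are the
points of the disjoint union of the charts, its arrows are the classes `[λ₁, a, λ₂]`. -/
noncomputable def spanGroupoid : TopGroupoid where
  Obj := Σ i, Pt.{u} (V i)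
  Arr := SpanArr V
  src := SpanArr.src
  tgt := SpanArr.tgt
  one x := Quot.mk _ (Triple.one x)
  inv := SpanArr.inv
  comp := SpanArr.comp
  src_one x := by
    change Triple.src _ = x
    simp [Triple.src, Triple.one, map_id]
  tgt_one x := by
    change Triple.tgt _ = x
    simp [Triple.tgt, Triple.one, map_id]
  src_inv a := by induction a using Quot.ind; rfl
  tgt_inv a := by induction a using Quot.ind; rfl
  src_comp a b h := by
    obtain ⟨R, S, T, rfl, rfl, hR⟩ := SpanArr.exists_composite a b h
    rw [SpanArr.comp_mk hR]
    exact hR.src_eq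
  tgt_comp a b h := by
    obtain ⟨R, S, T, rfl, rfl, hR⟩ := SpanArr.exists_composite a b h
    rw [SpanArr.comp_mk hR]
    exact hR.tgt_eq
  one_comp a := by
    induction a using Quot.ind with | _ S
    obtain ⟨⟨i, j, A, l, r⟩, a⟩ := S
    have h : Composite (V := V) (Triple.one ⟨i, map l a⟩) ⟨⟨i, j, A, l, r⟩, a⟩
        ⟨⟨i, j, A, l ≫ 𝟙 _, 𝟙 _ ≫ r⟩, a⟩ :=
      Composite.mk _ _ _ _ _ _ _ _ _ _ _ _ _ _ _ rfl (map_id _) (by simp)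
    refine (SpanArr.comp_mk h _).trans ?_
    rw [Category.id_comp, Category.comp_id]
  comp_one a := by
    induction a using Quot.ind with | _ S
    obtain ⟨⟨i, j, A, l, r⟩, a⟩ := S
    have h : Composite (V := V) ⟨⟨i, j, A, l, r⟩, a⟩ (Triple.one ⟨j, map r a⟩)
        ⟨⟨i, j, A, 𝟙 _ ≫ l, r ≫ 𝟙 _⟩, a⟩ :=
      Composite.mk _ _ _ _ _ _ _ _ _ _ _ _ _ _ _ (map_id _) rfl (by simp)
    refine (SpanArr.comp_mk h _).trans ?_
    rw [Category.id_comp, Category.comp_id]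
  assoc a b c h h' := by
    obtain ⟨R, S, T, rfl, rfl, hR⟩ := SpanArr.exists_composite a b h
    induction c using Quot.ind with | _ U
    obtain ⟨Q, hQ⟩ := Composite.exists (S := R) (T := U) (hR.tgt_eq.trans h')
    obtain ⟨P, hP⟩ := Composite.exists (S := T) (T := U) h'
    obtain ⟨Q', hQ'⟩ := Composite.exists (S := S) (T := P) (h.trans hP.src_eq.symm)
    have e1 : ∀ k, SpanArr.comp (SpanArr.comp (Quot.mk _ S) (Quot.mk _ T) h) (Quot.mk _ U) k =
        Quot.mk _ Q := by
      rw [SpanArr.comp_mk hR]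
      exact SpanArr.comp_mk hQ
    have e2 : ∀ k, SpanArr.comp (Quot.mk _ S) (SpanArr.comp (Quot.mk _ T) (Quot.mk _ U) h') k =
        Quot.mk _ Q' := by
      rw [SpanArr.comp_mk hP]
      exact SpanArr.comp_mk hQ'
    rw [e1, e2]
    cases hR with
    | mk i j k A B D l r m n ν μ a b d ha hb sq =>
      generalize hZ : (⟨⟨i, k, D, ν ≫ l, μ ≫ n⟩, d⟩ : Triple V) = Z at hQ
      cases hQ with
      | mk i' k' k₂ D' B₂ E l₂ r₂ p q σ τ d' c e hσ hτ sq' =>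
        cases hZ
        have hP' : Composite (V := V) ⟨⟨j, k, B, m, n⟩, b⟩ ⟨⟨k, k₂, B₂, p, q⟩, c⟩
            ⟨⟨j, k₂, E, (σ ≫ μ) ≫ m, τ ≫ q⟩, e⟩ :=
          Composite.mk _ _ _ _ _ _ _ _ _ _ _ _ _ _ _ (by rw [map_comp, hσ, hb]) hτ
            (by rw [Category.assoc, sq'])
        have hQ₂ : Composite (V := V) ⟨⟨i, j, A, l, r⟩, a⟩
            ⟨⟨j, k₂, E, (σ ≫ μ) ≫ m, τ ≫ q⟩, e⟩
            ⟨⟨i, k₂, E, (σ ≫ ν) ≫ l, 𝟙 _ ≫ τ ≫ q⟩, e⟩ :=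
          Composite.mk _ _ _ _ _ _ _ _ _ _ _ _ _ _ _ (by rw [map_comp, hσ, ha]) (map_id _)
            (by rw [Category.id_comp, Category.assoc, sq, Category.assoc])
        rw [hQ'.well_defined rfl (hP.unique hP') hQ₂, Category.id_comp, Category.assoc]
  comp_inv a := by
    induction a using Quot.ind with | _ S
    obtain ⟨⟨i, j, A, l, r⟩, a⟩ := S
    have h : Composite (V := V) ⟨⟨i, j, A, l, r⟩, a⟩ ⟨⟨j, i, A, r, l⟩, a⟩
        ⟨⟨i, i, A, 𝟙 _ ≫ l, 𝟙 _ ≫ l⟩, a⟩ :=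
      Composite.mk _ _ _ _ _ _ _ _ _ _ _ _ _ _ _ (map_id _) (map_id _) rfl
    refine (SpanArr.comp_mk h _).trans (Quot.sound ?_)
    exact Refines.mk i i (V i) A (𝟙 _) (𝟙 _) l _ _ a _ rfl (by simp) (by simp)
  inv_comp a := by
    induction a using Quot.ind with | _ S
    obtain ⟨⟨i, j, A, l, r⟩, a⟩ := S
    have h : Composite (V := V) ⟨⟨j, i, A, r, l⟩, a⟩ ⟨⟨i, j, A, l, r⟩, a⟩
        ⟨⟨j, j, A, 𝟙 _ ≫ r, 𝟙 _ ≫ r⟩, a⟩ :=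
      Composite.mk _ _ _ _ _ _ _ _ _ _ _ _ _ _ _ (map_id _) (map_id _) rfl
    refine (SpanArr.comp_mk h _).trans (Quot.sound ?_)
    exact Refines.mk j j (V j) A (𝟙 _) (𝟙 _) r _ _ a _ rfl (by simp) (by simp)
  continuous_src := SpanArr.continuous_src
  continuous_tgt := SpanArr.continuous_tgt
  continuous_one := continuous_sigma fun i => continuous_mk ⟨i, i, V i, 𝟙 _, 𝟙 _⟩
  continuous_inv := SpanArr.continuous_inv
  continuous_comp := SpanArr.continuous_comp

end ChartCat

/-! ## Finite groups of diffeomorphisms -/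

section FixedPoints

variable {n : ℕ} {V : Type u} [TopologicalSpace V] [ChartedSpace (EuclideanSpace ℝ (Fin n)) V]
  {G : Type w} [Group G] [Finite G] [MulAction G V]

theorem mem_interior_fixedBy_of_mem_closure [T2Space V]
    (hs : ∀ g : G, ContMDiff (𝓡 n) (𝓡 n) ∞ (fun x : V => g • x)) (g : G) (x : V)
    (hx : x ∈ closure (interior (MulAction.fixedBy V g))) :
    x ∈ interior (MulAction.fixedBy V g) := by
  classical
  have hgx : g • x = x := by
    have hcl : IsClosed (MulAction.fixedBy V g) :=
      isClosed_eq (hs g).continuous continuous_id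
    exact hcl.closure_subset_iff.2 interior_subset hx
  set e := extChartAt (𝓡 n) x with he
  have hfix : ∀ h ∈ Subgroup.zpowers g, ∀ z ∈ MulAction.fixedBy V g, h • z = z := by
    intro h hh z hz
    have : g ∈ MulAction.stabilizer G z := hz
    exact (Subgroup.zpowers_le.2 this) hh
  -- the local representative of an element of the cyclic group has derivative the identity
  have key : ∀ h : Subgroup.zpowers g, HasStrictFDerivAt (fun y => e ((h : G) • e.symm y))
      (ContinuousLinearMap.id ℝ (EuclideanSpace ℝ (Fin n))) (e x) := by
    intro h
    have hhx : (h : G) • x = x := hfix h h.2 x hgx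
    have h1 := ((contMDiffAt_iff.1 ((hs (h : G)) x)).2)
    rw [hhx] at h1
    have h2 : ContDiffAt ℝ ∞ (fun y => e ((h : G) • e.symm y)) (e x) := by
      rw [ModelWithCorners.range_eq_univ, contDiffWithinAt_univ] at h1
      exact h1
    have h3 := h2.hasStrictFDerivAt (by simp)
    suffices h4 : fderiv ℝ (fun y => e ((h : G) • e.symm y)) (e x) =
        ContinuousLinearMap.id ℝ (EuclideanSpace ℝ (Fin n)) by rwa [h4] at h3
    have hcont : ContinuousAt (fderiv ℝ (fun y => e ((h : G) • e.symm y))) (e x) :=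
      (h2.fderiv_right (m := 0) (by simp)).continuousAt
    have hcont' : ContinuousAt (fun z => fderiv ℝ (fun y => e ((h : G) • e.symm y)) (e z)) x :=
      ContinuousAt.comp (g := fderiv ℝ (fun y => e ((h : G) • e.symm y))) hcont
        (continuousAt_extChartAt x)
    have hev : ∃ᶠ z in 𝓝 x, fderiv ℝ (fun y => e ((h : G) • e.symm y)) (e z) =
        ContinuousLinearMap.id ℝ (EuclideanSpace ℝ (Fin n)) := by
      have hfr := mem_closure_iff_frequently.1 hx
      refine (hfr.and_eventually (extChartAt_source_mem_nhds (I := 𝓡 n) x)).mono ?_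
      rintro z ⟨hz, hzs⟩
      have hzt : e z ∈ e.target := e.map_source hzs
      have hopen : e.target ∈ 𝓝 (e z) := (isOpen_extChartAt_target x).mem_nhds hzt
      have hc : ContinuousAt e.symm (e z) :=
        (continuousOn_extChartAt_symm x).continuousAt hopen
      have hmem : ∀ᶠ y in 𝓝 (e z), e.symm y ∈ interior (MulAction.fixedBy V g) :=
        hc.eventually (by rw [e.left_inv hzs]; exact isOpen_interior.mem_nhds hz)
      have heq : (fun y => e ((h : G) • e.symm y)) =ᶠ[𝓝 (e z)] id := by
        filter_upwards [hmem, hopen] with y hy hyt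
        rw [hfix h h.2 _ (interior_subset hy), e.right_inv hyt, id]
      rw [heq.fderiv_eq, fderiv_id]
    have hclosed : IsClosed {L : EuclideanSpace ℝ (Fin n) →L[ℝ] EuclideanSpace ℝ (Fin n) |
      L = ContinuousLinearMap.id ℝ (EuclideanSpace ℝ (Fin n))} := isClosed_singleton
    exact hclosed.mem_of_frequently_of_tendsto hev hcont'
  have : Fintype (Subgroup.zpowers g) := Fintype.ofFinite _
  let s : V → EuclideanSpace ℝ (Fin n) := fun z =>
    (Fintype.card (Subgroup.zpowers g) : ℝ)⁻¹ • ∑ h : Subgroup.zpowers g, e ((h : G) • z)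
  have hsinv : ∀ z, s (g • z) = s z := by
    intro z
    simp only [s]
    congr 1
    have h := Equiv.sum_comp
      (Equiv.mulRight (⟨g, Subgroup.mem_zpowers g⟩ : Subgroup.zpowers g))
      (fun h : Subgroup.zpowers g => e ((h : G) • z))
    simpa [mul_smul] using h
  have hder : HasStrictFDerivAt (fun y => s (e.symm y))
      ((ContinuousLinearEquiv.refl ℝ (EuclideanSpace ℝ (Fin n)) :
        EuclideanSpace ℝ (Fin n) →L[ℝ] EuclideanSpace ℝ (Fin n))) (e x) := by
    have h1 := (HasStrictFDerivAt.fun_sum (u := Finset.univ) fun h _ => key h).const_smul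
      ((Fintype.card (Subgroup.zpowers g) : ℝ)⁻¹)
    have hc : (Fintype.card (Subgroup.zpowers g) : ℝ) ≠ 0 :=
      Nat.cast_ne_zero.2 Fintype.card_ne_zero
    have hL : (Fintype.card (Subgroup.zpowers g) : ℝ)⁻¹ • ∑ _h : Subgroup.zpowers g,
        ContinuousLinearMap.id ℝ (EuclideanSpace ℝ (Fin n)) =
        (ContinuousLinearEquiv.refl ℝ (EuclideanSpace ℝ (Fin n)) :
          EuclideanSpace ℝ (Fin n) →L[ℝ] EuclideanSpace ℝ (Fin n)) := by
      rw [Finset.sum_const, Finset.card_univ, ← Nat.cast_smul_eq_nsmul ℝ, smul_smul,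
        inv_mul_cancel₀ hc, one_smul]
      rfl
    rw [hL] at h1
    exact h1
  have hinj := hder.eventually_left_inverse
  set li := hder.localInverse _ _ _ with hli
  have hinj' : ∀ᶠ z in 𝓝 x, li (s z) = e z := by
    have h1 := (continuousAt_extChartAt (I := 𝓡 n) x).eventually hinj
    filter_upwards [h1, extChartAt_source_mem_nhds (I := 𝓡 n) x] with z hz hzs
    rwa [← he, e.left_inv hzs] at hz
  have hgc : Filter.Tendsto (fun z : V => g • z) (𝓝 x) (𝓝 x) := by
    have := (hs g).continuous.tendsto x
    rwa [hgx] at this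
  rw [mem_interior_iff_mem_nhds]
  filter_upwards [hinj', hgc.eventually hinj', extChartAt_source_mem_nhds (I := 𝓡 n) x,
    hgc.eventually (extChartAt_source_mem_nhds (I := 𝓡 n) x)] with z h1 h2 h3 h4
  rw [hsinv, h1] at h2
  exact (e.injOn h3 h4 h2).symm

/-- In a faithful smooth action of a finite group on a connected manifold, the fixed point sets
of non-trivial elements have empty interior. -/
theorem interior_fixedBy_eq_empty [T2Space V] [ConnectedSpace V] [FaithfulSMul G V]
    (hs : ∀ g : G, ContMDiff (𝓡 n) (𝓡 n) ∞ (fun x : V => g • x)) {g : G} (hg : g ≠ 1) :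
    interior (MulAction.fixedBy V g) = ∅ := by
  have hclopen : IsClopen (interior (MulAction.fixedBy V g)) :=
    ⟨isClosed_of_closure_subset fun x hx => mem_interior_fixedBy_of_mem_closure hs g x hx,
      isOpen_interior⟩
  rcases isClopen_iff.1 hclopen with h | h
  · exact h
  · refine absurd (eq_of_smul_eq_smul (α := V) fun x => ?_) hg
    have : x ∈ MulAction.fixedBy V g := interior_subset (h ▸ Set.mem_univ x)
    rw [one_smul]
    exact this

end FixedPoints

/-! ## Orbifold charts and their embeddings -/

/-- An `n`-dimensional orbifold chart (uniformizing system) of `X`: a connected smooth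
`n`-manifold `V` with a smooth effective action of a finite group `G` and a continuous map
`π : V → X` inducing a homeomorphism of `V / G` onto an open subset of `X`. -/
structure OrbifoldChart (n : ℕ) (X : Type v) [TopologicalSpace X] where
  V : Type u
  G : Type u
  [topologicalSpace : TopologicalSpace V]
  [chartedSpace : ChartedSpace (EuclideanSpace ℝ (Fin n)) V]
  [isManifold : IsManifold (𝓡 n) ∞ V]
  [t2Space : T2Space V]
  [secondCountable : SecondCountableTopology V]
  [connectedSpace : ConnectedSpace V]
  [group : Group G]
  [finite : Finite G]
  [mulAction : MulAction G V]
  [faithful : FaithfulSMul G V]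
  smooth : ∀ g : G, ContMDiff (𝓡 n) (𝓡 n) ∞ (fun x : V => g • x)
  π : V → X
  continuous_π : Continuous π
  isOpenMap_π : IsOpenMap π
  π_eq_iff : ∀ x y : V, π x = π y ↔ ∃ g : G, g • x = y

attribute [instance] OrbifoldChart.topologicalSpace OrbifoldChart.chartedSpace
  OrbifoldChart.isManifold OrbifoldChart.t2Space OrbifoldChart.secondCountable
  OrbifoldChart.connectedSpace OrbifoldChart.group OrbifoldChart.finite OrbifoldChart.mulAction
  OrbifoldChart.faithful

namespace OrbifoldChart

variable {n : ℕ} {X : Type v} [TopologicalSpace X]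

/-- An embedding `(λ, φ)` of orbifold charts: a smooth open embedding `λ` over `X` that is
equivariant along a monomorphism `φ`. -/
@[ext]
structure Embedding (A B : OrbifoldChart.{u, v} n X) where
  toFun : A.V → B.V
  hom : A.G →* B.G
  hom_injective : Function.Injective hom
  injective : Function.Injective toFun
  isLocalDiffeomorph : IsLocalDiffeomorph (𝓡 n) (𝓡 n) ∞ toFun
  equivariant : ∀ (g : A.G) (x : A.V), toFun (g • x) = hom g • toFun x
  π_comp : ∀ x, B.π (toFun x) = A.π x

theorem smul_localDiffeo (A : OrbifoldChart.{u, v} n X) (g : A.G) :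
    IsLocalDiffeomorph (𝓡 n) (𝓡 n) ∞ (fun x : A.V => g • x) :=
  Diffeomorph.isLocalDiffeomorph
    { toFun := fun x => g • x
      invFun := fun x => g⁻¹ • x
      left_inv := fun x => inv_smul_smul g x
      right_inv := fun x => smul_inv_smul g x
      contMDiff_toFun := A.smooth g
      contMDiff_invFun := A.smooth g⁻¹ }

instance : Category (OrbifoldChart.{u, v} n X) where
  Hom := Embedding
  id A :=
    { toFun := id
      hom := MonoidHom.id _
      hom_injective := Function.injective_id
      injective := Function.injective_id
      isLocalDiffeomorph := (Diffeomorph.refl (𝓡 n) A.V ∞).isLocalDiffeomorph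
      equivariant := fun _ _ => rfl
      π_comp := fun _ => rfl }
  comp f g :=
    { toFun := g.toFun ∘ f.toFun
      hom := g.hom.comp f.hom
      hom_injective := g.hom_injective.comp f.hom_injective
      injective := g.injective.comp f.injective
      isLocalDiffeomorph := fun x => (f.isLocalDiffeomorph x).comp (𝓡 n) _ (g.isLocalDiffeomorph _)
      equivariant := fun h x => by simp [f.equivariant, g.equivariant]
      π_comp := fun x => (g.π_comp _).trans (f.π_comp x) }

theorem Embedding.isOpenEmbedding {A B : OrbifoldChart.{u, v} n X} (f : A ⟶ B) :
    IsOpenEmbedding f.toFun :=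
  f.isLocalDiffeomorph.isLocalHomeomorph.isOpenEmbedding_of_injective f.injective

/-- The embedding `(λ_g, φ_g)` of a chart into itself, `λ_g(x) = g x`, `φ_g(a) = g a g⁻¹`. -/
def translate (A : OrbifoldChart.{u, v} n X) (g : A.G) : A ⟶ A where
  toFun x := g • x
  hom := (MulAut.conj g).toMonoidHom
  hom_injective := (MulAut.conj g).injective
  injective := MulAction.injective g
  isLocalDiffeomorph := A.smul_localDiffeo g
  equivariant h x := by simp [mul_smul]
  π_comp x := ((A.π_eq_iff _ _).2 ⟨g, rfl⟩).symm

/-- A group element moving a point of the image of an embedding to a point of the image comes from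
the source. -/
theorem Embedding.exists_hom_eq {A B : OrbifoldChart.{u, v} n X} (f : A ⟶ B) (c : B.G)
    (a a' : A.V) (h : c • f.toFun a = f.toFun a') : ∃ k, f.hom k = c := by
  by_contra! hne
  have hO : IsOpen (f.toFun ⁻¹' ((fun x => c • x) ⁻¹' Set.range f.toFun)) :=
    ((f.isOpenEmbedding.isOpen_range.preimage (B.smooth c).continuous).preimage
      f.isOpenEmbedding.continuous)
  have hO' := f.isOpenEmbedding.isOpenMap _ hO
  have hd : Dense (⋂ k : A.G, (MulAction.fixedBy B.V ((f.hom k)⁻¹ * c))ᶜ) := by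
    have : BaireSpace B.V := by
      have : LocallyCompactSpace B.V :=
        Manifold.locallyCompact_of_finiteDimensional (𝓡 n)
      infer_instance
    refine dense_iInter_of_isOpen (fun k => ?_) (fun k => ?_)
    · exact (isClosed_eq (B.smooth _).continuous continuous_id).isOpen_compl
    · rw [← interior_eq_empty_iff_dense_compl]
      refine interior_fixedBy_eq_empty B.smooth fun h1 => hne k ?_
      exact (inv_mul_eq_one.1 h1)
  obtain ⟨y, ⟨x, ⟨x', hx'⟩, rfl⟩, hy⟩ := hd.inter_open_nonempty _ hO' ⟨_, a, ⟨a', h.symm⟩, rfl⟩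
  have e : A.π x = A.π x' := by
    rw [← f.π_comp x', ← f.π_comp x, hx']
    exact (B.π_eq_iff _ _).2 ⟨c, rfl⟩
  obtain ⟨k, rfl⟩ := (A.π_eq_iff _ _).1 e
  refine (Set.mem_iInter.1 hy k) ?_
  change ((f.hom k)⁻¹ * c) • f.toFun x = f.toFun x
  change f.toFun (k • x) = c • f.toFun x at hx'
  rw [mul_smul, ← hx', f.equivariant, inv_smul_smul]

/-- Small neighbourhoods of a point that are stable under the isotropy group of that point. -/
theorem exists_stable_nhd (A : OrbifoldChart.{u, v} n X) (a : A.V) (N : Set A.V) (hN : IsOpen N)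
    (ha : a ∈ N) : ∃ Y : Set A.V, IsOpen Y ∧ IsConnected Y ∧ a ∈ Y ∧ Y ⊆ N ∧
      (∀ g : A.G, g • a = a → ∀ y ∈ Y, g • y ∈ Y) ∧
      (∀ g : A.G, ∀ y ∈ Y, g • y ∈ Y → g • a = a) := by
  have hcont : ∀ g : A.G, Continuous fun x : A.V => g • x := fun g => (A.smooth g).continuous
  have hlc : LocallyConnectedSpace A.V :=
    ChartedSpace.locallyConnectedSpace (EuclideanSpace ℝ (Fin n)) A.V
  have h0 : ∀ g : A.G, ∃ U : Set A.V, IsOpen U ∧ a ∈ U ∧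
      (g • a ≠ a → ∀ y ∈ U, g • y ∉ U) := by
    intro g
    by_cases hg : g • a = a
    · exact ⟨Set.univ, isOpen_univ, trivial, fun h => absurd hg h⟩
    · obtain ⟨U, U', hU, hU', h1, h2, hd⟩ := t2_separation hg
      exact ⟨U' ∩ (fun x => g • x) ⁻¹' U, hU'.inter (hU.preimage (hcont g)), ⟨h2, h1⟩,
        fun _ y hy hy' => Set.disjoint_left.1 hd hy.2 hy'.1⟩
  choose U hU haU hsep using h0
  let N₁ : Set A.V := N ∩ ⋂ g : A.G, U g
  have hN₁ : IsOpen N₁ := hN.inter (isOpen_iInter_of_finite hU)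
  have haN₁ : a ∈ N₁ := ⟨ha, Set.mem_iInter.2 haU⟩
  let N₂ : Set A.V := ⋂ g : MulAction.stabilizer A.G a, (fun x => (g : A.G) • x) ⁻¹' N₁
  have hN₂ : IsOpen N₂ := isOpen_iInter_of_finite fun g => hN₁.preimage (hcont g)
  have haN₂ : a ∈ N₂ := Set.mem_iInter.2 fun g => by
    change (g : A.G) • a ∈ N₁
    rw [show (g : A.G) • a = a from g.2]
    exact haN₁
  have hN₂₁ : N₂ ⊆ N₁ := fun y hy => by simpa using Set.mem_iInter.1 hy 1
  have hst : ∀ g : A.G, g • a = a → ∀ y ∈ N₂, g • y ∈ N₂ := by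
    intro g hg y hy
    refine Set.mem_iInter.2 fun h => ?_
    have := Set.mem_iInter.1 hy (h * ⟨g, hg⟩)
    simpa [mul_smul] using this
  refine ⟨connectedComponentIn N₂ a, hN₂.connectedComponentIn,
    isConnected_connectedComponentIn_iff.2 haN₂, mem_connectedComponentIn haN₂,
    (connectedComponentIn_subset _ _).trans (hN₂₁.trans Set.inter_subset_left), ?_, ?_⟩
  · intro g hg y hy
    have h1 : _root_.IsPreconnected ((fun x => g • x) '' connectedComponentIn N₂ a) :=
      isPreconnected_connectedComponentIn.image _ (hcont g).continuousOn
    refine h1.subset_connectedComponentIn ⟨a, mem_connectedComponentIn haN₂, hg⟩ ?_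
      ⟨y, hy, rfl⟩
    rintro _ ⟨z, hz, rfl⟩
    exact hst g hg z (connectedComponentIn_subset _ _ hz)
  · intro g y hy hgy
    by_contra hg
    have h1 := Set.mem_iInter.1 (hN₂₁ (connectedComponentIn_subset _ _ hy)).2 g
    have h2 := Set.mem_iInter.1 (hN₂₁ (connectedComponentIn_subset _ _ hgy)).2 g
    exact hsep g hg y h1 h2

/-- Data of a connected open set stable under a subgroup and moved off itself by all other
elements. -/
structure StableSet (A : OrbifoldChart.{u, v} n X) where
  Y : TopologicalSpace.Opens A.V
  H : Subgroup A.G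
  conn : IsConnected (Y : Set A.V)
  stable : ∀ g ∈ H, ∀ y ∈ Y, g • y ∈ Y
  mem : ∀ g : A.G, ∀ y ∈ Y, g • y ∈ Y → g ∈ H

/-- The restriction of a chart to a stable open set. -/
noncomputable def restrict (A : OrbifoldChart.{u, v} n X) (S : A.StableSet) :
    OrbifoldChart.{u, v} n X :=
  letI act : MulAction S.H S.Y :=
    { smul := fun g y => ⟨(g : A.G) • (y : A.V), S.stable g g.2 y y.2⟩
      one_smul := fun y => Subtype.ext (one_smul A.G (y : A.V))
      mul_smul := fun g h y => Subtype.ext (mul_smul (g : A.G) (h : A.G) (y : A.V)) }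
  haveI : ConnectedSpace S.Y := Subtype.connectedSpace S.conn
  haveI : FaithfulSMul S.H S.Y := ⟨fun {g h} hgh => by
    by_contra hne
    have h1 : (h : A.G)⁻¹ * g ≠ 1 := fun e => hne (Subtype.ext (inv_mul_eq_one.1 e).symm)
    have h2 := interior_fixedBy_eq_empty A.smooth h1
    obtain ⟨y, hy⟩ := S.conn.nonempty
    have h3 : (S.Y : Set A.V) ⊆ interior (MulAction.fixedBy A.V ((h : A.G)⁻¹ * g)) := by
      refine interior_maximal (fun z hz => ?_) S.Y.isOpen
      have := congrArg Subtype.val (hgh ⟨z, hz⟩)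
      change (g : A.G) • z = (h : A.G) • z at this
      change ((h : A.G)⁻¹ * g) • z = z
      rw [mul_smul, this, inv_smul_smul]
    rw [h2] at h3
    exact h3 hy⟩
  { V := S.Y
    G := S.H
    smooth := fun g => by
      rw [← ContMDiff.subtypeVal_comp_iff]
      exact (A.smooth g).comp contMDiff_subtype_val
    π := fun y => A.π y
    continuous_π := A.continuous_π.comp continuous_subtype_val
    isOpenMap_π := A.isOpenMap_π.comp S.Y.isOpen.isOpenMap_subtype_val
    π_eq_iff := fun x y => by
      rw [A.π_eq_iff]
      constructor
      · rintro ⟨g, hg⟩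
        exact ⟨⟨g, S.mem g x x.2 (by rw [hg]; exact y.2)⟩, Subtype.ext hg⟩
      · rintro ⟨g, hg⟩
        exact ⟨g, congrArg Subtype.val hg⟩ }

theorem isLocalDiffeomorph_val (A : OrbifoldChart.{u, v} n X) (Y : TopologicalSpace.Opens A.V) :
    IsLocalDiffeomorph (𝓡 n) (𝓡 n) ∞ (Subtype.val : Y → A.V) := by
  intro y
  have : Nonempty Y := ⟨y⟩
  refine ⟨{ toPartialEquiv := (Y.openPartialHomeomorphSubtypeCoe ⟨y⟩).toPartialEquiv
            open_source := (Y.openPartialHomeomorphSubtypeCoe ⟨y⟩).open_source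
            open_target := (Y.openPartialHomeomorphSubtypeCoe ⟨y⟩).open_target
            contMDiffOn_toFun := contMDiff_subtype_val.contMDiffOn
            contMDiffOn_invFun := ?_ }, trivial, fun _ _ => rfl⟩
  intro z hz
  rw [← ContMDiffWithinAt.subtypeVal_comp_iff]
  refine contMDiffWithinAt_id.congr (fun w hw => ?_) ?_
  · exact (Y.openPartialHomeomorphSubtypeCoe ⟨y⟩).right_inv hw
  · exact (Y.openPartialHomeomorphSubtypeCoe ⟨y⟩).right_inv hz

theorem isLocalDiffeomorph_of_comp {V₁ V₂ V₃ : Type u} [TopologicalSpace V₁]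
    [ChartedSpace (EuclideanSpace ℝ (Fin n)) V₁] [TopologicalSpace V₂]
    [ChartedSpace (EuclideanSpace ℝ (Fin n)) V₂] [TopologicalSpace V₃]
    [ChartedSpace (EuclideanSpace ℝ (Fin n)) V₃] {f : V₁ → V₃} {g : V₂ → V₃} {k : V₁ → V₂}
    (hf : IsLocalDiffeomorph (𝓡 n) (𝓡 n) ∞ f) (hg : IsLocalDiffeomorph (𝓡 n) (𝓡 n) ∞ g)
    (hinj : Function.Injective g) (h : ∀ x, g (k x) = f x) :
    IsLocalDiffeomorph (𝓡 n) (𝓡 n) ∞ k := by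
  intro x
  obtain ⟨Φ, hx, hΦ⟩ := hf x
  obtain ⟨Ψ, hy, hΨ⟩ := hg (k x)
  refine ⟨Φ.trans Ψ.symm, ⟨hx, ?_⟩, ?_⟩
  · change Φ x ∈ Ψ.target
    rw [← hΦ hx, ← h, hΨ hy]
    exact Ψ.map_source hy
  · rintro z ⟨hz, hz'⟩
    change Φ z ∈ Ψ.target at hz'
    change k z = Ψ.invFun (Φ z)
    apply hinj
    refine ((h z).trans (hΦ hz)).trans ?_
    exact ((hΨ (Ψ.map_target hz')).trans (Ψ.right_inv hz')).symm

/-- The inclusion of a restricted chart. -/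
noncomputable def restrictIncl (A : OrbifoldChart.{u, v} n X) (S : A.StableSet) :
    A.restrict S ⟶ A where
  toFun := Subtype.val
  hom := S.H.subtype
  hom_injective := S.H.subtype_injective
  injective := Subtype.val_injective
  isLocalDiffeomorph := A.isLocalDiffeomorph_val S.Y
  equivariant _ _ := rfl
  π_comp _ := rfl

/-- Embeddings with the same target are factored through each other. -/
theorem exists_lift {A B D : OrbifoldChart.{u, v} n X} (f : A ⟶ D) (g : B ⟶ D)
    (hr : ∀ a, f.toFun a ∈ Set.range g.toFun) : ∃ k : A ⟶ B, k ≫ g = f := by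
  choose k hk using hr
  have hG : ∀ h : A.G, ∃ c, g.hom c = f.hom h := fun h => by
    obtain ⟨a⟩ : Nonempty A.V := inferInstance
    exact g.exists_hom_eq (f.hom h) (k a) (k (h • a)) (by rw [hk, hk, f.equivariant])
  choose φ hφ using hG
  let e : A ⟶ B :=
    { toFun := k
      hom :=
        { toFun := φ
          map_one' := g.hom_injective (by rw [hφ, map_one, map_one])
          map_mul' := fun x y => g.hom_injective (by rw [hφ, map_mul, map_mul, hφ, hφ]) }
      hom_injective := fun x y hxy => f.hom_injective (by
        rw [← hφ, ← hφ]; exact congrArg g.hom hxy)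
      injective := fun x y hxy => f.injective (by rw [← hk, ← hk, hxy])
      isLocalDiffeomorph := isLocalDiffeomorph_of_comp f.isLocalDiffeomorph g.isLocalDiffeomorph
        g.injective hk
      equivariant := fun h x => g.injective (by
        rw [hk, f.equivariant, g.equivariant, hk]
        exact congrArg (· • f.toFun x) (hφ h).symm)
      π_comp := fun x => by rw [← g.π_comp, hk, f.π_comp] }
  refine ⟨e, Embedding.ext (funext hk) (MonoidHom.ext hφ)⟩

instance : ChartCat.{u} (OrbifoldChart.{u, v} n X) where
  Pt A := A.V
  top A := A.topologicalSpace
  map f := f.toFun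
  map_id _ := rfl
  map_comp _ _ _ := rfl
  isOpenEmbedding_map f := f.isOpenEmbedding
  mono f := ⟨fun g h e => Embedding.ext
    (funext fun x => f.injective (congrFun (congrArg Embedding.toFun e) x))
    (MonoidHom.ext fun x => f.hom_injective (DFunLike.congr_fun (congrArg Embedding.hom e) x))⟩
  refine {A B D} f g a b hab := by
    obtain ⟨Y, hY, hc, haY, hYN, h1, h2⟩ := A.exists_stable_nhd a (f.toFun ⁻¹' Set.range g.toFun)
      (g.isOpenEmbedding.isOpen_range.preimage f.isOpenEmbedding.continuous) ⟨b, hab.symm⟩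
    let S : A.StableSet := ⟨⟨Y, hY⟩, MulAction.stabilizer A.G a, hc, h1, h2⟩
    obtain ⟨k, hk⟩ := exists_lift (A.restrictIncl S ≫ f) g (fun y => hYN y.2)
    refine ⟨A.restrict S, ⟨a, haY⟩, A.restrictIncl S, k, rfl, ?_, hk.symm⟩
    apply g.injective
    rw [← hab]
    exact congrFun (congrArg Embedding.toFun hk) ⟨a, haY⟩

end OrbifoldChart

/-! ## Orbifolds and their groupoids -/

/-- An `n`-dimensional orbifold structure `{(V_p, G_p, π_p)}_{p ∈ X}` on `X`: every point `p` has
a chart of a neighbourhood of `p`, and for every point `q` in the image of the chart at `p` the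
charts at `p` and at `q` induce a common chart at `q`. -/
structure Orbifold (n : ℕ) (X : Type v) [TopologicalSpace X] where
  chart : X → OrbifoldChart.{u, v} n X
  mem_range : ∀ p, p ∈ Set.range (chart p).π
  compatible : ∀ p q, q ∈ Set.range (chart p).π → ∃ W : OrbifoldChart.{u, v} n X,
    q ∈ Set.range W.π ∧ Nonempty (W ⟶ chart p) ∧ Nonempty (W ⟶ chart q)

/-- A chart together with an element `k` of its group. -/
structure MarkedChart (n : ℕ) (X : Type v) [TopologicalSpace X] where
  chart : OrbifoldChart.{u, v} n X
  mark : chart.G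

namespace MarkedChart

variable {n : ℕ} {X : Type v} [TopologicalSpace X]

/-- An embedding of marked charts: an embedding `(λ, φ)` of charts such that `φ` respects the
marked elements. -/
@[ext]
structure Hom (A B : MarkedChart.{u, v} n X) where
  emb : A.chart ⟶ B.chart
  hom_mark : emb.hom A.mark = B.mark

instance : Category (MarkedChart.{u, v} n X) where
  Hom := Hom
  id A := ⟨𝟙 A.chart, rfl⟩
  comp f g := ⟨f.emb ≫ g.emb, (congrArg g.emb.hom f.hom_mark).trans g.hom_mark⟩

/-- The sector `V^k` of a marked chart `(V, G, k)`. -/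
abbrev Sector (A : MarkedChart.{u, v} n X) : Type u := {x : A.chart.V // A.mark • x = x}

theorem smul_iff {A B : MarkedChart.{u, v} n X} (f : A ⟶ B) (a : A.chart.V) :
    B.mark • f.emb.toFun a = f.emb.toFun a ↔ A.mark • a = a := by
  rw [← f.hom_mark, ← f.emb.equivariant]
  exact f.emb.injective.eq_iff

/-- The restriction `V^k → V'^{k'}` of an embedding of marked charts. -/
def sectorMap {A B : MarkedChart.{u, v} n X} (f : A ⟶ B) (x : A.Sector) : B.Sector :=
  ⟨f.emb.toFun x.1, (smul_iff f x.1).2 x.2⟩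

theorem isOpenEmbedding_sectorMap {A B : MarkedChart.{u, v} n X} (f : A ⟶ B) :
    IsOpenEmbedding (sectorMap f) := by
  have h := f.emb.isOpenEmbedding
  refine ⟨(h.isEmbedding.comp IsEmbedding.subtypeVal).codRestrict {y | B.mark • y = y}
    (fun x => (sectorMap f x).2), ?_⟩
  convert h.isOpen_range.preimage continuous_subtype_val using 1
  ext ⟨y, hy⟩
  constructor
  · rintro ⟨x, hx⟩
    exact ⟨x.1, congrArg Subtype.val hx⟩
  · rintro ⟨x, rfl⟩
    exact ⟨⟨x, (smul_iff f x).1 hy⟩, rfl⟩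

/-- Marked charts as a category of charts; the points of `(V, G, k)` are those of `V^k`. -/
instance : ChartCat.{u} (MarkedChart.{u, v} n X) where
  Pt A := A.Sector
  top A := instTopologicalSpaceSubtype
  map f := sectorMap f
  map_id _ := rfl
  map_comp _ _ _ := rfl
  isOpenEmbedding_map f := isOpenEmbedding_sectorMap f
  mono f := ⟨fun g h e => Hom.ext (by
    have := ChartCat.mono f.emb
    exact (cancel_mono f.emb).1 (congrArg Hom.emb e))⟩
  refine {A B D} f g a b hab := by
    obtain ⟨R, r, f', g', hf', hg', sq⟩ := ChartCat.refine f.emb g.emb a.1 b.1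
      (congrArg Subtype.val hab)
    change R.V at r
    change f'.toFun r = a.1 at hf'
    obtain ⟨k, hk⟩ := f'.exists_hom_eq A.mark r r (by rw [hf', a.2])
    have hk' : g'.hom k = B.mark := by
      apply g.emb.hom_injective
      rw [g.hom_mark, ← f.hom_mark, ← hk]
      exact (DFunLike.congr_fun (congrArg OrbifoldChart.Embedding.hom sq) k).symm
    have hr : k • r = r := by
      apply f'.injective
      rw [f'.equivariant, hk, hf', a.2]
    exact ⟨⟨R, k⟩, ⟨r, hr⟩, ⟨f', hk⟩, ⟨g', hk'⟩, Subtype.ext hf', Subtype.ext hg',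
      Hom.ext sq⟩

end MarkedChart

namespace Orbifold

variable {n : ℕ} {X : Type v} [TopologicalSpace X] (O : Orbifold.{u, v} n X)

/-- The groupoid associated with an orbifold: objects `⊔ₚ V_p`, arrows the classes
`[λ₁, w, λ₂]` with `λ₁ : W → V_p`, `λ₂ : W → V_q` embeddings of an arbitrary chart `W`. -/
noncomputable def groupoid : TopGroupoid := ChartCat.spanGroupoid O.chart

/-- A choice of one representative in every conjugacy class `(g) ⊂ G_p`, for every `p`. -/
structure Representatives where
  rep : ∀ p, ConjClasses (O.chart p).G → (O.chart p).G
  mk_rep : ∀ p c, ConjClasses.mk (rep p c) = c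

variable {O} (R : O.Representatives)

/-- The chart `(V_p, G_p)` marked with the representative `g` of a class `(g) ⊂ G_p`. -/
def Representatives.marked (i : Σ p, ConjClasses (O.chart p).G) : MarkedChart.{u, v} n X :=
  ⟨O.chart i.1, R.rep i.1 i.2⟩

/-- The groupoid of twisted sectors `Σ̃₁X`: its objects are `⊔ₚ ⊔_{(g) ⊂ G_p} V_p^g × {g}`, its
arrows from `V_p^g` to `V_q^h` are the classes `[λ₁, w, λ₂]` of embeddings
`(λ₁, φ₁) : (W, H) → (V_p, G_p)` and `(λ₂, φ₂) : (W, H) → (V_q, G_q)` with `φ₁(k) = g` and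
`φ₂(k) = h` for a `k ∈ H`, and of points `w ∈ W^k`. -/
noncomputable def twistedSectors : TopGroupoid := ChartCat.spanGroupoid R.marked

variable (O) in
/-- The loop `[id, x, λ_g]` at a point `x ∈ V_p^g`. -/
noncomputable def fixedLoop (p : X) (g : (O.chart p).G) (x : (O.chart p).V) (hx : g • x = x) :
    O.groupoid.Loop :=
  ⟨Quot.mk _ ⟨⟨p, p, O.chart p, 𝟙 _, (O.chart p).translate g⟩, x⟩, by
    change (⟨p, x⟩ : Σ p, (O.chart p).V) = ⟨p, g • x⟩
    rw [hx]⟩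

/-- The triple `(λ₁, w, λ₂)` of charts underlying a triple of marked charts. -/
def forgetMark (T : ChartCat.Triple R.marked) : ChartCat.Triple O.chart :=
  ⟨⟨T.1.i.1, T.1.j.1, T.1.apex.chart, T.1.left.emb, T.1.right.emb⟩, T.2.1⟩

/-- An element `z` of the centralizer of the mark `k` acts on the marked chart `(V, G, k)`. -/
def _root_.MarkedChart.translate (A : MarkedChart.{u, v} n X) (z : Subgroup.centralizer {A.mark}) :
    A ⟶ A :=
  ⟨A.chart.translate z, mul_inv_eq_of_eq_mul (Subgroup.mem_centralizer_singleton_iff.1 z.2)⟩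

/-- The arrow `[id, x, λ_z] : x ⟶ z x` of `Σ̃₁X`, for `x ∈ V_p^g` and `z ∈ C(g)`, where `g` is the
representative of the class `(g) ⊂ G_p`; the domain is the disjoint union `⊔_{(g)} V_p^g × C(g)`. -/
noncomputable def sectorArrow (p : X)
    (a : Σ j : (Σ c : ConjClasses (O.chart p).G, Subgroup.centralizer {(R.marked ⟨p, c⟩).mark}),
      (R.marked ⟨p, j.1⟩).Sector) : (twistedSectors R).Arr :=
  Quot.mk _ ⟨⟨⟨p, a.1.1⟩, ⟨p, a.1.1⟩, R.marked ⟨p, a.1.1⟩, 𝟙 _,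
    (R.marked ⟨p, a.1.1⟩).translate a.1.2⟩, a.2⟩

/-- The arrows `[id, x, λ_z]` compose as in the action groupoid of `C(g)` on `V_p^g`. -/
theorem sectorArrow_comp (p : X) (c : ConjClasses (O.chart p).G)
    (z z' : Subgroup.centralizer {(R.marked ⟨p, c⟩).mark}) (x : (R.marked ⟨p, c⟩).Sector) :
    (twistedSectors R).comp (sectorArrow R p ⟨⟨c, z⟩, x⟩)
      (sectorArrow R p ⟨⟨c, z'⟩, MarkedChart.sectorMap ((R.marked ⟨p, c⟩).translate z) x⟩) rfl =
    sectorArrow R p ⟨⟨c, z' * z⟩, x⟩ := by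
  let A := R.marked ⟨p, c⟩
  have hC : ChartCat.Composite (V := R.marked)
      ⟨⟨⟨p, c⟩, ⟨p, c⟩, A, 𝟙 A, A.translate z⟩, x⟩
      ⟨⟨⟨p, c⟩, ⟨p, c⟩, A, 𝟙 A, A.translate z'⟩, MarkedChart.sectorMap (A.translate z) x⟩
      ⟨⟨⟨p, c⟩, ⟨p, c⟩, A, 𝟙 A ≫ 𝟙 A, A.translate z ≫ A.translate z'⟩, x⟩ :=
    ChartCat.Composite.mk _ _ _ _ _ _ _ _ _ _ (𝟙 A) (A.translate z) _ _ x rfl rfl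
      ((Category.id_comp _).trans (Category.comp_id _).symm)
  have h : A.translate z ≫ A.translate z' = A.translate (z' * z) :=
    MarkedChart.Hom.ext (OrbifoldChart.Embedding.ext
      (funext fun y => (mul_smul z'.1 z.1 y).symm)
      (MonoidHom.ext fun y => (DFunLike.congr_fun
        (map_mul MulAut.conj z'.1 z.1) y).symm))
  rw [h, Category.id_comp] at hC
  exact ChartCat.SpanArr.comp_mk hC rfl

end Orbifold

/-!
Two embeddings of a chart into the same chart differ by an element of its group: a self-embedding
permutes the finite orbits, so it has finite order and is the identity as soon as it is the
identity near one point; hence embeddings with the same germ somewhere agree, and Baire's theorem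
produces a group element for which the germs agree. Consequently the loops of `𝖷` at `x ∈ V_p` are
the `[id, x, λ_g]` with `g • x = x`, the space of objects of `∧𝖷` is `⊔_p ⊔_{g ∈ G_p} V_p^g`, and an
arrow `[λ₁, w, λ₂]` of `𝖷` is an arrow from the loop of `g` to the loop of `h` in `∧𝖷` exactly when
some `k` is mapped to `g` by `φ₁` and to `h` by `φ₂`. So the twisted sectors include into `∧𝖷` as
the full subgroupoid on the chosen representatives. An element `z` with `z g z⁻¹` the representative
of `(g)`, chosen for every `g`, gives a continuous family of arrows which moves every loop into that
subgroupoid; conjugation by the family is a retraction `M`, fully faithful and open on objects,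
hence Morita.
-/

section FiniteOrder

variable {n : ℕ} {V : Type u} [TopologicalSpace V] [ChartedSpace (EuclideanSpace ℝ (Fin n)) V]
  [T2Space V] [ConnectedSpace V]

theorem eq_id_of_iterate_eq_id_of_interior_fixedPoints {f : V → V}
    (hf : ContMDiff (𝓡 n) (𝓡 n) ∞ f) {N : ℕ} (hN : 0 < N) (hfN : f^[N] = id)
    (hfix : (interior (Function.fixedPoints f)).Nonempty) : f = id := by
  obtain ⟨M, rfl⟩ : ∃ M, N = M + 1 := ⟨N - 1, by omega⟩
  let σ : Equiv.Perm V := ⟨f, f^[M], congrFun hfN,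
    fun x => (Function.iterate_succ_apply' f M x).symm.trans (congrFun hfN x)⟩
  have hσ : IsOfFinOrder σ :=
    isOfFinOrder_iff_pow_eq_one.2 ⟨M + 1, hN, DFunLike.coe_injective hfN⟩
  have : Finite (Subgroup.zpowers σ) := Set.finite_coe_iff.2 hσ.finite_zpowers
  have smooth_zpowers (τ : Subgroup.zpowers σ) : ContMDiff (𝓡 n) (𝓡 n) ∞ (τ • · : V → V) := by
    obtain ⟨k, hk⟩ := hσ.mem_powers_iff_mem_zpowers.2 τ.2
    have hτ : (τ • · : V → V) = f^[k] := congrArg DFunLike.coe hk.symm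
    exact hτ ▸ hf.iterate k
  by_contra hne
  have hσ1 : (⟨σ, Subgroup.mem_zpowers σ⟩ : Subgroup.zpowers σ) ≠ 1 := fun h =>
    hne (congrArg DFunLike.coe (congrArg Subtype.val h))
  exact hfix.ne_empty (interior_fixedBy_eq_empty smooth_zpowers hσ1)

end FiniteOrder

namespace OrbifoldChart

variable {n : ℕ} {X : Type v} [TopologicalSpace X] {A B : OrbifoldChart.{u, v} n X}

theorem Embedding.iterate_factorial_card_eq_id (e : A ⟶ A) :
    e.toFun^[(Nat.card A.G).factorial] = id := by
  funext x
  have orbit_mapsTo : Set.MapsTo e.toFun (MulAction.orbit A.G x) (MulAction.orbit A.G x) := by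
    rintro _ ⟨g, rfl⟩
    obtain ⟨h, hh⟩ := (A.π_eq_iff x (e.toFun (g • x))).1
      (((A.π_eq_iff x (g • x)).2 ⟨g, rfl⟩).trans (e.π_comp _).symm)
    exact ⟨h, hh⟩
  let e' := orbit_mapsTo.restrict
  have : Finite (MulAction.orbit A.G x) := Set.finite_range _
  have : Fintype (MulAction.orbit A.G x) := Fintype.ofFinite _
  have hinj : Function.Injective e' := (orbit_mapsTo.restrict_inj).2 e.injective.injOn
  let y : MulAction.orbit A.G x := ⟨x, MulAction.mem_orbit_self x⟩
  have period_le : Function.minimalPeriod e' y ≤ Nat.card A.G :=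
    (Function.minimalPeriod_le_card).trans (by
      rw [← Nat.card_eq_fintype_card]
      exact Nat.card_le_card_of_surjective _ Set.rangeFactorization_surjective)
  have hper : Function.IsPeriodicPt e' (Nat.card A.G).factorial y :=
    Function.isPeriodicPt_iff_minimalPeriod_dvd.2 (Nat.dvd_factorial
      (Function.minimalPeriod_pos_of_mem_periodicPts (hinj.mem_periodicPts y)) period_le)
  have := congrArg Subtype.val hper.eq
  rwa [orbit_mapsTo.iterate_restrict] at this

theorem Embedding.toFun_eq_id_of_interior_fixedPoints (e : A ⟶ A)
    (he : (interior (Function.fixedPoints e.toFun)).Nonempty) : e.toFun = id :=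
  eq_id_of_iterate_eq_id_of_interior_fixedPoints e.isLocalDiffeomorph.contMDiff
    (Nat.factorial_pos _) e.iterate_factorial_card_eq_id he

theorem exists_stableSet {a : A.V} {N : Set A.V} (hN : N ∈ 𝓝 a) :
    ∃ S : A.StableSet, S.H = MulAction.stabilizer A.G a ∧ a ∈ S.Y ∧ (S.Y : Set A.V) ⊆ N := by
  obtain ⟨U, hUN, hU, haU⟩ := mem_nhds_iff.1 hN
  obtain ⟨Y, hY, hc, haY, hYU, hstable, hmem⟩ := A.exists_stable_nhd a U hU haU
  exact ⟨⟨⟨Y, hY⟩, MulAction.stabilizer A.G a, hc, hstable, hmem⟩, rfl, haY, hYU.trans hUN⟩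

theorem Embedding.exists_restrict_comp_eq (f f' : A ⟶ B) {z : A.V} (hz : f.toFun z = f'.toFun z) :
    ∃ (S : A.StableSet) (e : A.restrict S ⟶ A.restrict S), z ∈ S.Y ∧
      e ≫ A.restrictIncl S ≫ f = A.restrictIncl S ≫ f' := by
  obtain ⟨S, hS, hzS, -⟩ := exists_stableSet (Filter.univ_mem (f := 𝓝 z))
  have hN : (S.Y : Set A.V) ∩ f'.toFun ⁻¹' (f.toFun '' S.Y) ∈ 𝓝 z :=
    ((S.Y.isOpen.inter ((f.isOpenEmbedding.isOpenMap _ S.Y.isOpen).preimage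
      f'.isOpenEmbedding.continuous)).mem_nhds ⟨hzS, z, hzS, hz⟩)
  obtain ⟨T, hT, hzT, hTN⟩ := exists_stableSet hN
  refine (exists_lift (A.restrictIncl T ≫ f') (A.restrictIncl T ≫ f) fun y => ?_).elim
    fun e he => ⟨T, e, hzT, he⟩
  obtain ⟨hyS, y', hy'S, hy'⟩ := hTN y.2
  have hπ : A.π y.1 = A.π y' := by
    rw [← f.π_comp y', hy', f'.π_comp]
  obtain ⟨g, rfl⟩ := (A.π_eq_iff _ _).1 hπ
  have hg : g ∈ T.H := hT ▸ hS ▸ S.mem g y.1 hyS hy'S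
  exact ⟨⟨g • y.1, T.stable g hg y.1 y.2⟩, hy'⟩

theorem Embedding.eq_of_smul_eq_smul (f : A ⟶ B) {g h : B.G}
    (hgh : ∀ x, g • f.toFun x = h • f.toFun x) : g = h := by
  by_contra hne
  have hfix : Set.range f.toFun ⊆ interior (MulAction.fixedBy B.V (h⁻¹ * g)) :=
    interior_maximal (by
      rintro _ ⟨x, rfl⟩
      rw [MulAction.mem_fixedBy, mul_smul, hgh, inv_smul_smul]) f.isOpenEmbedding.isOpen_range
  rw [interior_fixedBy_eq_empty B.smooth (fun e => hne (inv_mul_eq_one.1 e).symm)] at hfix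
  obtain ⟨x⟩ : Nonempty A.V := inferInstance
  exact hfix ⟨x, rfl⟩

theorem Embedding.eq_of_toFun_eq {f f' : A ⟶ B} (h : f.toFun = f'.toFun) : f = f' :=
  Embedding.ext h (MonoidHom.ext fun a => f.eq_of_smul_eq_smul fun x => by
    rw [← f.equivariant, h, f'.equivariant])

theorem Embedding.translate_injective (f : A ⟶ B) :
    Function.Injective fun g => f ≫ B.translate g := fun _ _ h =>
  f.eq_of_smul_eq_smul (congrFun (congrArg Embedding.toFun h))

theorem Embedding.translate_comp (f : A ⟶ B) (k : A.G) :
    A.translate k ≫ f = f ≫ B.translate (f.hom k) :=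
  eq_of_toFun_eq (funext fun x => f.equivariant k x)

theorem Embedding.mem_interior_eqLocus_of_mem_closure (f f' : A ⟶ B) {z : A.V}
    (hz : z ∈ closure (interior {x | f.toFun x = f'.toFun x})) :
    z ∈ interior {x | f.toFun x = f'.toFun x} := by
  have hclosed : IsClosed {x | f.toFun x = f'.toFun x} :=
    isClosed_eq f.isOpenEmbedding.continuous f'.isOpenEmbedding.continuous
  obtain ⟨S, e, hzS, he⟩ := f.exists_restrict_comp_eq f'
    (hclosed.closure_subset_iff.2 interior_subset hz)
  have he (y : S.Y) : f.toFun (e.toFun y).1 = f'.toFun y.1 :=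
    congrFun (congrArg Embedding.toFun he) y
  have hfix : (interior (Function.fixedPoints e.toFun)).Nonempty := by
    obtain ⟨y, hy, hyS⟩ := mem_closure_iff.1 hz _ S.Y.isOpen hzS
    refine ⟨⟨y, hy⟩, interior_maximal (fun x hx => ?_)
      (isOpen_interior.preimage continuous_subtype_val) hyS⟩
    exact Subtype.ext (f.injective ((he x).trans (interior_subset hx).symm))
  have hid := e.toFun_eq_id_of_interior_fixedPoints hfix
  refine interior_maximal (fun x hx => ?_) S.Y.isOpen hzS
  exact (congrArg (f.toFun ∘ Subtype.val) (congrFun hid ⟨x, hx⟩)).symm.trans (he ⟨x, hx⟩)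

theorem Embedding.eq_of_interior_eqLocus_nonempty (f f' : A ⟶ B)
    (h : (interior {x | f.toFun x = f'.toFun x}).Nonempty) : f = f' := by
  have hclopen : IsClopen (interior {x | f.toFun x = f'.toFun x}) :=
    ⟨isClosed_of_closure_subset fun _ => f.mem_interior_eqLocus_of_mem_closure f',
      isOpen_interior⟩
  exact eq_of_toFun_eq (funext (Set.eq_univ_iff_forall.1 (interior_eq_univ.1 (hclopen.eq_univ h))))

theorem Embedding.exists_comp_translate (f f' : A ⟶ B) : ∃ g, f ≫ B.translate g = f' := by
  have hclosed (g : B.G) : IsClosed {x | (f ≫ B.translate g).toFun x = f'.toFun x} :=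
    isClosed_eq (f ≫ B.translate g).isOpenEmbedding.continuous f'.isOpenEmbedding.continuous
  have hcover : ⋃ g, {x | (f ≫ B.translate g).toFun x = f'.toFun x} = Set.univ :=
    Set.eq_univ_of_forall fun x => Set.mem_iUnion.2 <|
      (B.π_eq_iff _ _).1 ((f.π_comp x).trans (f'.π_comp x).symm)
  have : LocallyCompactSpace A.V := Manifold.locallyCompact_of_finiteDimensional (𝓡 n)
  obtain ⟨g, hg⟩ := nonempty_interior_of_iUnion_of_closed hclosed hcover
  exact ⟨g, eq_of_interior_eqLocus_nonempty _ _ hg⟩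

end OrbifoldChart

theorem isOpenMap_snd_pullback {A B D : Type*} [TopologicalSpace A] [TopologicalSpace B]
    [TopologicalSpace D] {f : A → D} {g : B → D} (hf : IsOpenMap f) (hg : Continuous g) :
    IsOpenMap fun p : {p : A × B // f p.1 = g p.2} => p.1.2 := by
  intro U hU
  obtain ⟨W, hW, rfl⟩ := isOpen_induced_iff.1 hU
  rw [isOpen_iff_mem_nhds]
  rintro _ ⟨⟨⟨a, b⟩, hab⟩, hp, rfl⟩
  obtain ⟨S, T, hS, hT, haS, hbT, hST⟩ := isOpen_prod_iff.1 hW a b hp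
  filter_upwards [((hf S hS).preimage hg).mem_nhds ⟨a, haS, hab⟩, hT.mem_nhds hbT]
  rintro b' ⟨a', ha', hab'⟩ hb'
  exact ⟨⟨(a', b'), hab'⟩, hST ⟨ha', hb'⟩, rfl⟩

namespace TopGroupoid

section Cancellation

variable (G : TopGroupoid.{u, v})

theorem inv_comp_cancel_left (a b : G.Arr) (h : G.tgt a = G.src b) :
    G.comp (G.inv a) (G.comp a b h) (by rw [G.src_comp, G.tgt_inv]) = b := by
  rw [← G.assoc _ _ _ (G.tgt_inv a) h, G.comp_congr (G.inv_comp a) rfl,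
    G.comp_congr (congrArg G.one h) rfl, G.one_comp]

theorem comp_inv_cancel_left (a b : G.Arr) (h : G.src a = G.src b) :
    G.comp a (G.comp (G.inv a) b ((G.tgt_inv a).trans h)) (by rw [G.src_comp, G.src_inv]) = b := by
  rw [← G.assoc _ _ _ (G.src_inv a).symm ((G.tgt_inv a).trans h), G.comp_congr (G.comp_inv a) rfl,
    G.comp_congr (congrArg G.one h) rfl, G.one_comp]

theorem comp_inv_cancel_right (a b : G.Arr) (h : G.tgt a = G.src b) :
    G.comp (G.comp a b h) (G.inv b) (by rw [G.tgt_comp, G.src_inv]) = a := by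
  rw [G.assoc _ _ _ h (G.src_inv b).symm, G.comp_congr rfl (G.comp_inv b),
    G.comp_congr rfl (congrArg G.one h.symm), G.comp_one]

theorem inv_comp_cancel_right (a b : G.Arr) (h : G.tgt a = G.tgt b) :
    G.comp (G.comp a (G.inv b) (h.trans (G.src_inv b).symm)) b (by rw [G.tgt_comp, G.tgt_inv]) =
      a := by
  rw [G.assoc _ _ _ (h.trans (G.src_inv b).symm) (G.tgt_inv b), G.comp_congr rfl (G.inv_comp b),
    G.comp_congr rfl (congrArg G.one h.symm), G.comp_one]

theorem comp_left_cancel {a b b' : G.Arr} {h : G.tgt a = G.src b} {h' : G.tgt a = G.src b'}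
    (e : G.comp a b h = G.comp a b' h') : b = b' := by
  rw [← G.inv_comp_cancel_left a b h, ← G.inv_comp_cancel_left a b' h']
  exact G.comp_congr rfl e _

end Cancellation

theorem continuous_inertia_arr (G : TopGroupoid.{u, v}) :
    Continuous fun β : G.inertia.Arr => (β : G.LoopArr).1.2.1 :=
  continuous_fst.comp (continuous_snd.comp continuous_subtype_val)

namespace Hom

variable {G : TopGroupoid.{u, v}} {H : TopGroupoid.{w, w₁}}

/-- A morphism given by continuous maps compatible with sources, targets and composition;
compatibility with units and inverses is automatic by cancellation. -/
def ofComp (obj : G.Obj → H.Obj) (arr : G.Arr → H.Arr) (continuous_obj : Continuous obj)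
    (continuous_arr : Continuous arr) (src_arr : ∀ a, H.src (arr a) = obj (G.src a))
    (tgt_arr : ∀ a, H.tgt (arr a) = obj (G.tgt a))
    (arr_comp : ∀ a b (h : G.tgt a = G.src b), arr (G.comp a b h) =
      H.comp (arr a) (arr b) ((tgt_arr a).trans ((congrArg obj h).trans (src_arr b).symm))) :
    Hom G H :=
  have arr_one (x : G.Obj) : arr (G.one x) = H.one (obj x) := by
    have hx : H.tgt (arr (G.one x)) = obj x := by rw [tgt_arr, G.tgt_one]
    have h_idem : G.comp (G.one x) (G.one x) ((G.tgt_one x).trans (G.src_one x).symm) = G.one x :=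
      (G.comp_congr (congrArg G.one (G.src_one x).symm) rfl _).trans (G.one_comp (G.one x))
    refine H.comp_left_cancel (h' := hx.trans (H.src_one _).symm)
      ((arr_comp _ _ _).symm.trans ((congrArg arr h_idem).trans ?_))
    rw [H.comp_congr rfl (congrArg H.one hx.symm), H.comp_one]
  { obj := obj
    arr := arr
    continuous_obj := continuous_obj
    continuous_arr := continuous_arr
    src_arr := src_arr
    tgt_arr := tgt_arr
    arr_comp := arr_comp
    arr_one := arr_one
    arr_inv := fun a => H.comp_left_cancel (by
      rw [← arr_comp a (G.inv a) (G.src_inv a).symm, G.comp_inv, arr_one, H.comp_inv, src_arr]) }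

/-- The condition that the square formed by the arrow map, the anchor maps and the object map is
cartesian in topological spaces; it is the first half of `IsMorita`. -/
def IsFullyFaithful (Φ : Hom G H) : Prop :=
  IsHomeomorph fun a : G.Arr =>
    (⟨((G.src a, G.tgt a), Φ.arr a), (Φ.src_arr a).symm, (Φ.tgt_arr a).symm⟩ :
      {p : (G.Obj × G.Obj) × H.Arr // Φ.obj p.1.1 = H.src p.2 ∧ Φ.obj p.1.2 = H.tgt p.2})

namespace IsFullyFaithful

theorem of_isEmbedding {Φ : Hom G H} (hobj : Function.Injective Φ.obj) (harr : IsEmbedding Φ.arr)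
    (hfull : ∀ x y b, H.src b = Φ.obj x → H.tgt b = Φ.obj y → ∃ a, Φ.arr a = b) :
    Φ.IsFullyFaithful := by
  refine isHomeomorph_iff_isEmbedding_surjective.2 ⟨?_, ?_⟩
  · refine .of_comp (Continuous.subtype_mk ((G.continuous_src.prodMk G.continuous_tgt).prodMk
      Φ.continuous_arr) _) continuous_subtype_val.snd harr
  · rintro ⟨⟨⟨x, y⟩, b⟩, hx, hy⟩
    obtain ⟨a, rfl⟩ := hfull x y b hx.symm hy.symm
    exact ⟨a, Subtype.ext (Prod.ext (Prod.ext (hobj (hx.trans (Φ.src_arr a)).symm)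
      (hobj (hy.trans (Φ.tgt_arr a)).symm)) rfl)⟩

variable {Φ : Hom G H} (hΦ : Φ.IsFullyFaithful)
include hΦ

theorem arr_ext {a b : G.Arr} (hsrc : G.src a = G.src b) (htgt : G.tgt a = G.tgt b)
    (harr : Φ.arr a = Φ.arr b) : a = b :=
  hΦ.injective (Subtype.ext (Prod.ext (Prod.ext hsrc htgt) harr))

/-- The inverse of the comparison map of a fully faithful morphism: the unique arrow with given
source, target and image. -/
noncomputable def preimage
    (p : {p : (G.Obj × G.Obj) × H.Arr // Φ.obj p.1.1 = H.src p.2 ∧ Φ.obj p.1.2 = H.tgt p.2}) :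
    G.Arr :=
  (IsHomeomorph.homeomorph _ hΦ).symm p

theorem continuous_preimage : Continuous hΦ.preimage :=
  (IsHomeomorph.homeomorph _ hΦ).symm.continuous

theorem preimage_surjective : Function.Surjective hΦ.preimage :=
  (IsHomeomorph.homeomorph _ hΦ).symm.surjective

variable (p : {p : (G.Obj × G.Obj) × H.Arr // Φ.obj p.1.1 = H.src p.2 ∧ Φ.obj p.1.2 = H.tgt p.2})

theorem src_preimage : G.src (hΦ.preimage p) = p.1.1.1 :=
  congrArg (·.1.1.1) ((IsHomeomorph.homeomorph _ hΦ).apply_symm_apply p)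

theorem tgt_preimage : G.tgt (hΦ.preimage p) = p.1.1.2 :=
  congrArg (·.1.1.2) ((IsHomeomorph.homeomorph _ hΦ).apply_symm_apply p)

theorem arr_preimage : Φ.arr (hΦ.preimage p) = p.1.2 :=
  congrArg (·.1.2) ((IsHomeomorph.homeomorph _ hΦ).apply_symm_apply p)

end IsFullyFaithful

section Lift

variable {K : TopGroupoid} {ι : Hom H G} (hι : ι.IsFullyFaithful) (Ψ : Hom K G)
  {r : K.Obj → H.Obj} (hr : Continuous r) (h : ∀ x, ι.obj (r x) = Ψ.obj x)

/-- The factorization through a fully faithful `ι` of a morphism `Ψ` whose object map factors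
through `ι`. -/
noncomputable def lift : Hom K H :=
  ofComp r
    (fun a => hι.preimage ⟨((r (K.src a), r (K.tgt a)), Ψ.arr a),
      (h _).trans (Ψ.src_arr a).symm, (h _).trans (Ψ.tgt_arr a).symm⟩)
    hr
    (hι.continuous_preimage.comp (Continuous.subtype_mk
      (((hr.comp K.continuous_src).prodMk (hr.comp K.continuous_tgt)).prodMk Ψ.continuous_arr) _))
    (fun _ => hι.src_preimage _)
    (fun _ => hι.tgt_preimage _)
    (fun a b hab => by
      refine hι.arr_ext ?_ ?_ ?_
      · rw [hι.src_preimage, H.src_comp, hι.src_preimage]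
        exact congrArg r (K.src_comp a b hab)
      · rw [hι.tgt_preimage, H.tgt_comp, hι.tgt_preimage]
        exact congrArg r (K.tgt_comp a b hab)
      · rw [hι.arr_preimage, ι.arr_comp,
          G.comp_congr (hι.arr_preimage _) (hι.arr_preimage _)]
        exact Ψ.arr_comp a b hab)

theorem arr_lift (a : K.Arr) : ι.arr ((lift hι Ψ hr h).arr a) = Ψ.arr a :=
  hι.arr_preimage _

theorem isFullyFaithful_lift (hΨ : Ψ.IsFullyFaithful) :
    (lift hι Ψ hr h).IsFullyFaithful := by
  let inverse (p : {p : (K.Obj × K.Obj) × H.Arr // r p.1.1 = H.src p.2 ∧ r p.1.2 = H.tgt p.2}) :=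
    hΨ.preimage ⟨(p.1.1, ι.arr p.1.2), by rw [← h, p.2.1, ι.src_arr], by
      rw [← h, p.2.2, ι.tgt_arr]⟩
  refine isHomeomorph_iff_exists_inverse.2 ⟨?_, inverse, ?_, ?_, ?_⟩
  · exact Continuous.subtype_mk ((K.continuous_src.prodMk K.continuous_tgt).prodMk
      (lift hι Ψ hr h).continuous_arr) _
  · intro a
    exact hΨ.arr_ext (hΨ.src_preimage _) (hΨ.tgt_preimage _)
      ((hΨ.arr_preimage _).trans (arr_lift hι Ψ hr h a))
  · intro p
    refine Subtype.ext (Prod.ext (Prod.ext (hΨ.src_preimage _) (hΨ.tgt_preimage _)) ?_)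
    refine hι.arr_ext ?_ ?_ ((arr_lift hι Ψ hr h _).trans (hΨ.arr_preimage _))
    · exact ((lift hι Ψ hr h).src_arr _).trans ((congrArg r (hΨ.src_preimage _)).trans p.2.1)
    · exact ((lift hι Ψ hr h).tgt_arr _).trans ((congrArg r (hΨ.tgt_preimage _)).trans p.2.2)
  · exact hΨ.continuous_preimage.comp (Continuous.subtype_mk
      ((continuous_subtype_val.fst).prodMk (ι.continuous_arr.comp continuous_subtype_val.snd)) _)

end Lift

section Conj

variable {ζ : G.Obj → G.Arr} (hζ : Continuous ζ) (hsrc : ∀ x, G.src (ζ x) = x)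

/-- The endomorphism of `G` which moves every object `x` along an arrow `ζ x` with source `x`, and
sends an arrow `a : x ⟶ y` to `(ζ x)⁻¹ · a · ζ y`. -/
def conj : Hom G G :=
  have h_comp (a : G.Arr) : G.tgt a = G.src (ζ (G.tgt a)) := (hsrc _).symm
  have h_inv (a : G.Arr) :
      G.tgt (G.inv (ζ (G.src a))) = G.src (G.comp a (ζ (G.tgt a)) (h_comp a)) :=
    (G.tgt_inv _).trans ((hsrc _).trans (G.src_comp _ _ _).symm)
  ofComp (fun x => G.tgt (ζ x))
    (fun a => G.comp (G.inv (ζ (G.src a))) (G.comp a (ζ (G.tgt a)) (h_comp a)) (h_inv a))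
    (G.continuous_tgt.comp hζ)
    (G.continuous_comp' (G.continuous_inv.comp (hζ.comp G.continuous_src))
      (G.continuous_comp' continuous_id (hζ.comp G.continuous_tgt) _) _)
    (fun a => (G.src_comp _ _ _).trans (G.src_inv _))
    (fun a => (G.tgt_comp _ _ _).trans (G.tgt_comp _ _ _))
    (fun a b hab => by
      have hζb : G.src (ζ (G.src b)) = G.src (G.comp b (ζ (G.tgt b)) (h_comp b)) :=
        (hsrc _).trans (G.src_comp _ _ _).symm
      calc
        _ = G.comp (G.inv (ζ (G.src a))) (G.comp a (G.comp b (ζ (G.tgt b)) (h_comp b))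
              (hab.trans (G.src_comp _ _ _).symm))
              ((G.tgt_inv _).trans ((hsrc _).trans (G.src_comp _ _ _).symm)) :=
          G.comp_congr (congrArg (fun x => G.inv (ζ x)) (G.src_comp a b hab))
            ((G.comp_congr rfl (congrArg ζ (G.tgt_comp a b hab)) _).trans
              (G.assoc a b _ hab (h_comp b))) _
        _ = _ := by
          rw [G.assoc _ _ _ (h_inv a) (by rw [G.tgt_comp, G.src_comp, G.src_inv, hab])]
          refine G.comp_congr rfl (Eq.symm ?_) _
          rw [G.assoc _ _ _ (h_comp a) (by rw [G.src_comp, G.src_inv, hab])]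
          exact G.comp_congr rfl ((G.comp_congr (congrArg ζ hab) rfl _).trans
            (G.comp_inv_cancel_left _ _ hζb)) _)

theorem isFullyFaithful_conj : (conj hζ hsrc).IsFullyFaithful := by
  have h_left (p : {p : (G.Obj × G.Obj) × G.Arr //
      G.tgt (ζ p.1.1) = G.src p.2 ∧ G.tgt (ζ p.1.2) = G.tgt p.2}) :
      G.tgt (G.comp (ζ p.1.1.1) p.1.2 p.2.1) = G.src (G.inv (ζ p.1.1.2)) := by
    rw [G.tgt_comp, G.src_inv, p.2.2]
  refine isHomeomorph_iff_exists_inverse.2 ⟨?_,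
    fun p => G.comp (G.comp (ζ p.1.1.1) p.1.2 p.2.1) (G.inv (ζ p.1.1.2)) (h_left p), ?_, ?_, ?_⟩
  · exact Continuous.subtype_mk ((G.continuous_src.prodMk G.continuous_tgt).prodMk
      (conj hζ hsrc).continuous_arr) _
  · intro a
    exact (G.comp_congr (G.comp_inv_cancel_left _ _ (by rw [hsrc, G.src_comp])) rfl _).trans
      (G.comp_inv_cancel_right a _ _)
  · rintro ⟨⟨⟨x, y⟩, b⟩, hx : G.tgt (ζ x) = G.src b, hy : G.tgt (ζ y) = G.tgt b⟩
    have hx' : G.src (G.comp (G.comp (ζ x) b hx) (G.inv (ζ y)) (h_left ⟨((x, y), b), hx, hy⟩)) =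
      x := by rw [G.src_comp, G.src_comp, hsrc]
    have hy' : G.tgt (G.comp (G.comp (ζ x) b hx) (G.inv (ζ y)) (h_left ⟨((x, y), b), hx, hy⟩)) =
      y := by rw [G.tgt_comp, G.tgt_inv, hsrc]
    refine Subtype.ext (Prod.ext (Prod.ext hx' hy') ?_)
    refine (G.comp_congr (congrArg (fun z => G.inv (ζ z)) hx') ((G.comp_congr rfl
      (congrArg ζ hy') _).trans (G.inv_comp_cancel_right _ (ζ y) ?_)) _).trans
      (G.inv_comp_cancel_left (ζ x) b hx)
    exact (G.tgt_comp _ _ _).trans hy.symm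
  · exact G.continuous_comp' (G.continuous_comp' (hζ.comp continuous_subtype_val.fst.fst)
      continuous_subtype_val.snd _) (G.continuous_inv.comp
      (hζ.comp continuous_subtype_val.fst.snd)) _

end Conj

theorem IsFullyFaithful.isMorita {Φ : Hom G H} (hΦ : Φ.IsFullyFaithful) (hobj : IsOpenMap Φ.obj)
    (hsrc : IsOpenMap H.src) (hess : ∀ y, ∃ x b, Φ.obj x = H.tgt b ∧ H.src b = y) :
    Φ.IsMorita where
  cartesian := hΦ
  isOpenMap := hsrc.comp (isOpenMap_snd_pullback hobj H.continuous_tgt)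
  surjective y := by
    obtain ⟨x, b, hb, rfl⟩ := hess y
    exact ⟨⟨(x, b), hb⟩, rfl⟩

theorem IsFullyFaithful.exists_isMorita_of_deformation {ι : Hom H G} (hι : ι.IsFullyFaithful)
    (hsrc : IsOpenMap H.src) {ζ : G.Obj → G.Arr} (hζ : Continuous ζ)
    (hζsrc : ∀ x, G.src (ζ x) = x) {r : G.Obj → H.Obj} (hr : Continuous r) (hro : IsOpenMap r)
    (hιr : ∀ x, ι.obj (r x) = G.tgt (ζ x)) : ∃ M : Hom G H, M.IsMorita := by
  have hff := isFullyFaithful_lift hι _ hr hιr (isFullyFaithful_conj hζ hζsrc)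
  refine ⟨lift hι (conj hζ hζsrc) hr hιr, hff.isMorita hro hsrc fun y => ?_⟩
  let b := hι.preimage ⟨((y, r (ι.obj y)), ζ (ι.obj y)), (hζsrc _).symm, hιr _⟩
  have hb : H.tgt b = r (ι.obj y) := hι.tgt_preimage _
  exact ⟨ι.obj y, b, hb.symm, hι.src_preimage _⟩

theorem IsMorita.isOpenMap_src {Φ : Hom G H} (hΦ : Φ.IsMorita) : IsOpenMap G.src := by
  have hff : Φ.IsFullyFaithful := hΦ.cartesian
  let rearrange (p : {p : {p : G.Obj × H.Arr // Φ.obj p.1 = H.tgt p.2} × G.Obj //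
      H.src p.1.1.2 = Φ.obj p.2}) :
      {p : (G.Obj × G.Obj) × H.Arr // Φ.obj p.1.1 = H.src p.2 ∧ Φ.obj p.1.2 = H.tgt p.2} :=
    ⟨((p.1.2, p.1.1.1.1), p.1.1.1.2), p.2.symm, p.1.1.2⟩
  have hcont : Continuous rearrange := by fun_prop
  have hsurj : Function.Surjective rearrange := fun ⟨((x, y), b), hx, hy⟩ =>
    ⟨⟨(⟨(y, b), hy⟩, x), hx.symm⟩, rfl⟩
  have hopen : IsOpenMap (G.src ∘ hff.preimage ∘ rearrange) := by
    convert isOpenMap_snd_pullback hΦ.isOpenMap Φ.continuous_obj using 1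
    exact funext fun p => hff.src_preimage (rearrange p)
  intro U hU
  rw [← Set.image_preimage_eq U (hff.preimage_surjective.comp hsurj), ← Set.image_comp]
  exact hopen _ (hU.preimage (hff.continuous_preimage.comp hcont))

/-- The identity morphism. -/
def id (G : TopGroupoid.{u, v}) : Hom G G :=
  ofComp _root_.id _root_.id continuous_id continuous_id (fun _ => rfl) (fun _ => rfl)
    (fun _ _ _ => rfl)

theorem isMorita_id (hsrc : IsOpenMap G.src) : (Hom.id G).IsMorita := by
  refine IsFullyFaithful.isMorita ?_ IsOpenMap.id hsrc fun y =>
    ⟨y, G.one y, (G.tgt_one y).symm, G.src_one y⟩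
  refine isHomeomorph_iff_exists_inverse.2 ⟨?_, fun p => p.1.2, fun _ => rfl, ?_, by fun_prop⟩
  · exact Continuous.subtype_mk
      ((G.continuous_src.prodMk G.continuous_tgt).prodMk continuous_id) _
  · exact fun ⟨_, hx, hy⟩ => Subtype.ext (Prod.ext (Prod.ext hx.symm hy.symm) rfl)

theorem IsMorita.moritaEquivalent {G : TopGroupoid.{max u w, max v w₁}}
    {H : TopGroupoid.{w, w₁}} {Φ : Hom G H} (hΦ : Φ.IsMorita) : MoritaEquivalent G H :=
  ⟨G, Hom.id G, Φ, isMorita_id hΦ.isOpenMap_src, hΦ⟩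

end Hom

end TopGroupoid

namespace ChartCat

variable {C : Type w} [Category.{w₁} C] [ChartCat.{u} C] {I : Type v} {V : I → C}

theorem mk_eq_mk_iff {i j : I} {A A' : C} {l : A ⟶ V i} {r : A ⟶ V j} {l' : A' ⟶ V i}
    {r' : A' ⟶ V j} {a : Pt.{u} A} {a' : Pt.{u} A'} :
    (Quot.mk _ ⟨⟨i, j, A, l, r⟩, a⟩ : SpanArr V) = Quot.mk _ ⟨⟨i, j, A', l', r'⟩, a'⟩ ↔
      ∃ (B : C) (ν : B ⟶ A) (ν' : B ⟶ A') (b : Pt.{u} B), map ν b = a ∧ map ν' b = a' ∧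
        ν ≫ l = ν' ≫ l' ∧ ν ≫ r = ν' ≫ r' := by
  rw [mk_eq_iff]
  constructor
  · rintro ⟨W, h, h'⟩
    cases h with
    | mk _ _ _ B _ _ ν _ _ b _ hb hl hr =>
      cases h' with
      | mk _ _ _ _ _ _ ν' _ _ _ _ hb' hl' hr' =>
        exact ⟨B, ν, ν', b, hb, hb', hl.trans hl'.symm, hr.trans hr'.symm⟩
  · rintro ⟨B, ν, ν', b, hb, hb', hl, hr⟩
    exact ⟨⟨⟨i, j, B, ν ≫ l, ν ≫ r⟩, b⟩, Refines.mk _ _ _ _ _ _ _ _ _ _ _ hb rfl rfl,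
      Refines.mk _ _ _ _ _ _ _ _ _ _ _ hb' hl.symm hr.symm⟩

theorem mk_eq_mk_iff_right {i j : I} {A : C} {l : A ⟶ V i} {r r' : A ⟶ V j} {a : Pt.{u} A} :
    (Quot.mk _ ⟨⟨i, j, A, l, r⟩, a⟩ : SpanArr V) = Quot.mk _ ⟨⟨i, j, A, l, r'⟩, a⟩ ↔
      ∃ (B : C) (ν : B ⟶ A) (b : Pt.{u} B), map ν b = a ∧ ν ≫ r = ν ≫ r' := by
  rw [mk_eq_mk_iff]
  constructor
  · rintro ⟨B, ν, ν', b, hb, -, hl, hr⟩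
    have := ChartCat.mono l
    obtain rfl := (cancel_mono l).1 hl
    exact ⟨B, ν, b, hb, hr⟩
  · rintro ⟨B, ν, b, hb, hr⟩
    exact ⟨B, ν, ν, b, hb, hb, rfl, hr⟩

theorem mk_comp_right {i j : I} {A : C} (l : A ⟶ V i) (t : V i ⟶ V j) (a : Pt.{u} A) :
    (Quot.mk _ ⟨⟨i, j, A, l, l ≫ t⟩, a⟩ : SpanArr V) =
      Quot.mk _ ⟨⟨i, j, V i, 𝟙 _, t⟩, map l a⟩ :=
  Quot.sound (Refines.mk _ _ _ _ _ _ l _ _ _ _ rfl (Category.comp_id l) rfl)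

theorem SpanArr.isOpenMap_of_mk {Y : Type*} [TopologicalSpace Y] {f : SpanArr V → Y}
    (hf : ∀ S : Span V, IsOpenMap fun a : Pt.{u} S.apex => f (Quot.mk _ ⟨S, a⟩)) :
    IsOpenMap f := by
  intro U hU
  rw [← Set.image_preimage_eq U Quot.mk_surjective, ← Set.image_comp]
  exact isOpenMap_sigma.2 hf _ (hU.preimage continuous_quot_mk)

theorem SpanArr.isOpenMap_src : IsOpenMap (SpanArr.src : SpanArr V → _) :=
  isOpenMap_of_mk fun S => (isOpenMap_sigmaMk (σ := fun i => Pt.{u} (V i))).comp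
    (isOpenEmbedding_map S.left).isOpenMap

end ChartCat

namespace OrbifoldChart

variable {n : ℕ} {X : Type v} [TopologicalSpace X] {A B : OrbifoldChart.{u, v} n X}

theorem Embedding.comp_translate_hom (f : A ⟶ B) (z : B.G) (k : A.G) :
    (f ≫ B.translate z).hom k = z * f.hom k * z⁻¹ :=
  rfl

end OrbifoldChart

namespace MarkedChart

variable {n : ℕ} {X : Type v} [TopologicalSpace X] {A B : MarkedChart.{u, v} n X}

theorem Hom.exists_comp_translate (f f' : A ⟶ B) : ∃ z, f ≫ B.translate z = f' := by
  obtain ⟨z, hz⟩ := OrbifoldChart.Embedding.exists_comp_translate f.emb f'.emb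
  have h_comm : z * B.mark * z⁻¹ = B.mark := by
    have := f'.hom_mark
    rwa [← hz, OrbifoldChart.Embedding.comp_translate_hom, f.hom_mark] at this
  exact ⟨⟨z, Subgroup.mem_centralizer_singleton_iff.2 (mul_inv_eq_iff_eq_mul.1 h_comm)⟩,
    Hom.ext hz⟩

end MarkedChart

namespace Orbifold

open ChartCat OrbifoldChart

variable {n : ℕ} {X : Type v} [TopologicalSpace X] (O : Orbifold.{u, v} n X)

/-- The disjoint union of the fixed point sets `V_p^g` for all `p` and all `g ∈ G_p`. -/
abbrev FixedPt : Type (max u v) :=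
  Σ j : (Σ p, (O.chart p).G), {x : (O.chart j.1).V // j.2 • x = x}

/-- The loop `[id, x, λ_g]` at a point `x ∈ V_p^g`, as a map on the union of all `V_p^g`. -/
noncomputable def loopOfFixed (d : O.FixedPt) : O.groupoid.Loop :=
  O.fixedLoop d.1.1 d.1.2 d.2.1 d.2.2

theorem mk_translate_eq_iff {p q : X} {A : OrbifoldChart.{u, v} n X} {l : A ⟶ O.chart p}
    {r : A ⟶ O.chart q} {a : A.V} {g h : (O.chart q).G} :
    (Quot.mk _ ⟨⟨p, q, A, l, r ≫ (O.chart q).translate g⟩, a⟩ : SpanArr O.chart) =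
      Quot.mk _ ⟨⟨p, q, A, l, r ≫ (O.chart q).translate h⟩, a⟩ ↔ g = h := by
  rw [mk_eq_mk_iff_right]
  constructor
  · rintro ⟨B, ν, b, -, e⟩
    exact Embedding.translate_injective (ν ≫ r) (by simpa only [Category.assoc] using e)
  · rintro rfl
    exact ⟨A, 𝟙 A, a, rfl, rfl⟩

theorem continuous_loopOfFixed : Continuous O.loopOfFixed :=
  continuous_sigma fun j => Continuous.subtype_mk
    ((continuous_mk (V := O.chart) ⟨j.1, j.1, O.chart j.1, 𝟙 _, (O.chart j.1).translate j.2⟩).comp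
      continuous_subtype_val) _

theorem isOpenMap_loopOfFixed : IsOpenMap O.loopOfFixed := by
  rw [isOpenMap_sigma]
  rintro ⟨p, g⟩ U hU
  obtain ⟨U', hU', rfl⟩ := isOpen_induced_iff.1 hU
  have hopen := isOpenMap_mk (V := O.chart)
    ⟨p, p, O.chart p, 𝟙 _, (O.chart p).translate g⟩ U' hU'
  refine (congrArg IsOpen (Set.Subset.antisymm ?_ ?_)).mpr (hopen.preimage continuous_subtype_val)
  · rintro _ ⟨x, hx, rfl⟩
    exact ⟨x.1, hx, rfl⟩
  · rintro ⟨v, hv⟩ ⟨(x : (O.chart p).V), hx, rfl⟩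
    have hgx : x = g • x := sigma_mk_injective (β := fun p => (O.chart p).V) hv
    exact ⟨⟨x, hgx.symm⟩, hx, rfl⟩

theorem loopOfFixed_injective : Function.Injective O.loopOfFixed := by
  rintro ⟨⟨p, g⟩, x, hx⟩ ⟨⟨q, h⟩, y, hy⟩ e
  have hsrc : (⟨p, x⟩ : Σ p, (O.chart p).V) = ⟨q, y⟩ :=
    congrArg (fun l : O.groupoid.Loop => O.groupoid.src l.1) e
  cases hsrc
  obtain rfl : g = h := (O.mk_translate_eq_iff (l := 𝟙 _) (r := 𝟙 _) (a := x)).1 (by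
    rw [Category.id_comp, Category.id_comp]
    exact congrArg Subtype.val e)
  rfl

theorem loopOfFixed_surjective : Function.Surjective O.loopOfFixed := by
  rintro ⟨⟨⟨p, q, A, l, r⟩, a⟩, ha⟩
  obtain rfl : p = q := congrArg Sigma.fst ha
  have hlr : l.toFun a = r.toFun a := sigma_mk_injective (β := fun p => (O.chart p).V) ha
  obtain ⟨g, rfl⟩ := Embedding.exists_comp_translate l r
  exact ⟨⟨⟨p, g⟩, l.toFun a, hlr.symm⟩, Subtype.ext (mk_comp_right (V := O.chart) l _ a).symm⟩

/-- The loops of the groupoid of an orbifold are the points of `⊔ₚ ⊔_{g ∈ G_p} V_p^g`. -/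
noncomputable def loopHomeomorph : O.FixedPt ≃ₜ O.groupoid.Loop :=
  Equiv.toHomeomorphOfContinuousOpen
    (Equiv.ofBijective _ ⟨O.loopOfFixed_injective, O.loopOfFixed_surjective⟩)
    O.continuous_loopOfFixed O.isOpenMap_loopOfFixed

section Conjugation

variable {p q : X} {A : OrbifoldChart.{u, v} n X} (l : A ⟶ O.chart p) (r : A ⟶ O.chart q) (a : A.V)

theorem fixedLoop_comp (k : A.G) (hk : l.hom k • l.toFun a = l.toFun a)
    (h : O.groupoid.tgt (O.fixedLoop p (l.hom k) _ hk).1 =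
      O.groupoid.src (Quot.mk _ ⟨⟨p, q, A, l, r⟩, a⟩)) :
    O.groupoid.comp (O.fixedLoop p (l.hom k) _ hk).1 (Quot.mk _ ⟨⟨p, q, A, l, r⟩, a⟩) h =
      Quot.mk _ ⟨⟨p, q, A, l, r ≫ (O.chart q).translate (r.hom k)⟩, a⟩ := by
  have hka : k • a = a := l.injective ((l.equivariant k a).trans hk)
  have hC : Composite (V := O.chart)
      ⟨⟨p, p, O.chart p, 𝟙 _, (O.chart p).translate (l.hom k)⟩, l.toFun a⟩
      ⟨⟨p, q, A, l, r⟩, a⟩ ⟨⟨p, q, A, l ≫ 𝟙 _, A.translate k ≫ r⟩, a⟩ :=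
    Composite.mk _ _ _ _ _ _ _ _ _ _ _ _ _ _ _ rfl hka (Embedding.translate_comp l k).symm
  rw [Category.comp_id, Embedding.translate_comp] at hC
  exact SpanArr.comp_mk hC h

theorem comp_fixedLoop (g : (O.chart q).G) (hg : g • r.toFun a = r.toFun a)
    (h : O.groupoid.tgt (Quot.mk _ ⟨⟨p, q, A, l, r⟩, a⟩) =
      O.groupoid.src (O.fixedLoop q g _ hg).1) :
    O.groupoid.comp (Quot.mk _ ⟨⟨p, q, A, l, r⟩, a⟩) (O.fixedLoop q g _ hg).1 h =
      Quot.mk _ ⟨⟨p, q, A, l, r ≫ (O.chart q).translate g⟩, a⟩ := by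
  have hC : Composite (V := O.chart) ⟨⟨p, q, A, l, r⟩, a⟩
      ⟨⟨q, q, O.chart q, 𝟙 _, (O.chart q).translate g⟩, r.toFun a⟩
      ⟨⟨p, q, A, 𝟙 _ ≫ l, r ≫ (O.chart q).translate g⟩, a⟩ :=
    Composite.mk _ _ _ _ _ _ _ _ _ _ _ _ _ _ _ rfl rfl
      ((Category.id_comp _).trans (Category.comp_id _).symm)
  rw [Category.id_comp] at hC
  exact SpanArr.comp_mk hC h

theorem fixedLoop_conj_iff {g : (O.chart p).G} {h : (O.chart q).G}
    (hg : g • l.toFun a = l.toFun a) (hh : h • r.toFun a = r.toFun a) :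
    (∃ (h₁ : O.groupoid.tgt (O.fixedLoop p g _ hg).1 =
          O.groupoid.src (Quot.mk _ ⟨⟨p, q, A, l, r⟩, a⟩))
        (h₂ : O.groupoid.tgt (Quot.mk _ ⟨⟨p, q, A, l, r⟩, a⟩) =
          O.groupoid.src (O.fixedLoop q h _ hh).1),
        O.groupoid.comp (O.fixedLoop p g _ hg).1 (Quot.mk _ ⟨⟨p, q, A, l, r⟩, a⟩) h₁ =
          O.groupoid.comp (Quot.mk _ ⟨⟨p, q, A, l, r⟩, a⟩) (O.fixedLoop q h _ hh).1 h₂) ↔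
      ∃ k, l.hom k = g ∧ r.hom k = h := by
  obtain ⟨k, rfl⟩ := l.exists_hom_eq g a a hg
  constructor
  · rintro ⟨h₁, h₂, e⟩
    rw [fixedLoop_comp, comp_fixedLoop] at e
    exact ⟨k, rfl, O.mk_translate_eq_iff.1 e⟩
  · rintro ⟨k', hk', rfl⟩
    obtain rfl := l.hom_injective hk'
    exact ⟨congrArg (Sigma.mk p) hg, rfl,
      (O.fixedLoop_comp l r a k' hg _).trans (O.comp_fixedLoop l r a _ hh _).symm⟩

end Conjugation

variable {O} (R : O.Representatives)

theorem forgetMark_refines {S T : Triple R.marked} (h : Refines S T) :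
    Refines (forgetMark R S) (forgetMark R T) := by
  cases h with
  | mk i j A B l r ν l' r' b a hb hl hr =>
    exact Refines.mk _ _ _ _ _ _ ν.emb _ _ _ _ (congrArg Subtype.val hb)
      (congrArg MarkedChart.Hom.emb hl) (congrArg MarkedChart.Hom.emb hr)

theorem forgetMark_composite {S T U : Triple R.marked} (h : Composite S T U) :
    Composite (forgetMark R S) (forgetMark R T) (forgetMark R U) := by
  cases h with
  | mk i j k A B D l r m n ν μ a b d ha hb sq =>
    exact Composite.mk _ _ _ _ _ _ _ _ _ _ ν.emb μ.emb _ _ _ (congrArg Subtype.val ha)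
      (congrArg Subtype.val hb) (congrArg MarkedChart.Hom.emb sq)

/-- The arrow `[λ₁, w, λ₂]` of `𝖷` underlying an arrow of the twisted sectors. -/
noncomputable def sectorForget (a : (twistedSectors R).Arr) : O.groupoid.Arr :=
  Quot.map (forgetMark R) (fun _ _ => forgetMark_refines R) a

/-- A point of `V_p^g`, `g` the representative of a class, as a fixed point. -/
def sectorFixed : (twistedSectors R).Obj → O.FixedPt :=
  Sigma.map (fun i => ⟨i.1, R.rep i.1 i.2⟩) fun _ x => x

theorem continuous_sectorForget : Continuous (sectorForget R) :=
  continuous_quot_lift _ <| continuous_sigma fun S =>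
    (continuous_mk (V := O.chart)
      ⟨S.i.1, S.j.1, S.apex.chart, S.left.emb, S.right.emb⟩).comp continuous_subtype_val

theorem sectorForget_comp (a b : (twistedSectors R).Arr)
    (h : (twistedSectors R).tgt a = (twistedSectors R).src b) :
    ∃ h' : O.groupoid.tgt (sectorForget R a) = O.groupoid.src (sectorForget R b),
      sectorForget R ((twistedSectors R).comp a b h) =
        O.groupoid.comp (sectorForget R a) (sectorForget R b) h' := by
  obtain ⟨U, S, T, rfl, rfl, hU⟩ := SpanArr.exists_composite a b h
  have hU' := forgetMark_composite R hU
  exact ⟨hU'.tgt_eq_src, (congrArg (sectorForget R) (SpanArr.comp_mk hU h)).trans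
    (SpanArr.comp_mk hU' hU'.tgt_eq_src).symm⟩

theorem isOpenEmbedding_sectorFixed : IsOpenEmbedding (sectorFixed R) :=
  have h_inj : Function.Injective fun i : Σ p, ConjClasses (O.chart p).G =>
      (⟨i.1, R.rep i.1 i.2⟩ : Σ p, (O.chart p).G) :=
    Function.injective_id.sigma_map fun p => Function.LeftInverse.injective (R.mk_rep p)
  (isOpenEmbedding_sigmaMap h_inj).2 fun _ => .id

theorem sectorForget_conj (a : (twistedSectors R).Arr) :
    ∃ (h₁ : O.groupoid.tgt (O.loopOfFixed (sectorFixed R ((twistedSectors R).src a))).1 =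
        O.groupoid.src (sectorForget R a))
      (h₂ : O.groupoid.tgt (sectorForget R a) =
        O.groupoid.src (O.loopOfFixed (sectorFixed R ((twistedSectors R).tgt a))).1),
      O.groupoid.comp (O.loopOfFixed (sectorFixed R ((twistedSectors R).src a))).1
          (sectorForget R a) h₁ =
        O.groupoid.comp (sectorForget R a)
          (O.loopOfFixed (sectorFixed R ((twistedSectors R).tgt a))).1 h₂ := by
  obtain ⟨⟨i, j, A, l, r⟩, a⟩ := a
  exact (O.fixedLoop_conj_iff l.emb r.emb a.1 (MarkedChart.sectorMap l a).2
    (MarkedChart.sectorMap r a).2).2 ⟨A.mark, l.hom_mark, r.hom_mark⟩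

theorem isOpenEmbedding_loopOfFixed_sectorFixed :
    IsOpenEmbedding fun x => O.loopOfFixed (sectorFixed R x) :=
  O.loopHomeomorph.isOpenEmbedding.comp (isOpenEmbedding_sectorFixed R)

/-- The inclusion `ι` of the twisted sectors into the inertia groupoid. -/
noncomputable def sectorIncl : TopGroupoid.Hom (twistedSectors R) O.groupoid.inertia :=
  have h_cont := (isOpenEmbedding_loopOfFixed_sectorFixed R).continuous
  .ofComp (fun x => O.loopOfFixed (sectorFixed R x))
    (fun a => ⟨(O.loopOfFixed (sectorFixed R ((twistedSectors R).src a)), sectorForget R a,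
      O.loopOfFixed (sectorFixed R ((twistedSectors R).tgt a))), sectorForget_conj R a⟩)
    h_cont
    (Continuous.subtype_mk ((h_cont.comp (twistedSectors R).continuous_src).prodMk
      ((continuous_sectorForget R).prodMk (h_cont.comp (twistedSectors R).continuous_tgt))) _)
    (fun _ => rfl) (fun _ => rfl)
    (fun a b h => Subtype.ext (Prod.ext
      (congrArg (fun y => O.loopOfFixed (sectorFixed R y)) ((twistedSectors R).src_comp a b h))
      (Prod.ext (sectorForget_comp R a b h).choose_spec
        (congrArg (fun y => O.loopOfFixed (sectorFixed R y))
          ((twistedSectors R).tgt_comp a b h)))))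

theorem isOpenEmbedding_sectorIncl_obj : IsOpenEmbedding (sectorIncl R).obj :=
  isOpenEmbedding_loopOfFixed_sectorFixed R

theorem sectorIncl_full (x y : (twistedSectors R).Obj) (β : O.groupoid.inertia.Arr)
    (hx : O.groupoid.inertia.src β = (sectorIncl R).obj x)
    (hy : O.groupoid.inertia.tgt β = (sectorIncl R).obj y) : ∃ a, (sectorIncl R).arr a = β := by
  obtain ⟨⟨_, ⟨⟨p, q, A, l, r⟩, a⟩, _⟩, hsrc, htgt, e⟩ := β
  cases hx
  cases hy
  obtain ⟨⟨p', c⟩, x, hgx⟩ := x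
  obtain ⟨⟨q', d⟩, y, hgy⟩ := y
  obtain rfl : p' = p := congrArg Sigma.fst hsrc
  obtain rfl : q = q' := congrArg Sigma.fst htgt
  obtain rfl : x = l.toFun a :=
    hgx.symm.trans (sigma_mk_injective (β := fun p => (O.chart p).V) hsrc)
  obtain rfl : r.toFun a = y := sigma_mk_injective (β := fun p => (O.chart p).V) htgt
  obtain ⟨k, hk, hk'⟩ := (O.fixedLoop_conj_iff l r a hgx hgy).1 ⟨hsrc, htgt, e⟩
  let l' : (⟨A, k⟩ : MarkedChart.{u, v} n X) ⟶ R.marked ⟨p', c⟩ := ⟨l, hk⟩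
  exact ⟨Quot.mk _ ⟨⟨⟨p', c⟩, ⟨q, d⟩, ⟨A, k⟩, l', ⟨r, hk'⟩⟩,
    ⟨a, (MarkedChart.smul_iff l' a).1 hgx⟩⟩, rfl⟩

theorem sectorIncl_arr_injective : Function.Injective (sectorIncl R).arr := by
  intro α β e
  have hsrc : (twistedSectors R).src α = (twistedSectors R).src β :=
    (isOpenEmbedding_sectorIncl_obj R).injective (congrArg (fun γ => γ.1.1) e)
  have htgt : (twistedSectors R).tgt α = (twistedSectors R).tgt β :=
    (isOpenEmbedding_sectorIncl_obj R).injective (congrArg (fun γ => γ.1.2.2) e)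
  have hmid : sectorForget R α = sectorForget R β := congrArg (fun γ => γ.1.2.1) e
  obtain ⟨⟨i, j, A, l, r⟩, a⟩ := α
  obtain ⟨⟨i', j', A', l', r'⟩, a'⟩ := β
  obtain rfl : i = i' := congrArg Sigma.fst hsrc
  obtain rfl : j = j' := congrArg Sigma.fst htgt
  obtain ⟨B, ν, ν', b, hb, hb', hl, hr⟩ := (mk_eq_mk_iff (V := O.chart)).1 hmid
  change B.V at b
  change ν.toFun b = a.1 at hb
  obtain ⟨k, hk⟩ := ν.exists_hom_eq A.mark b b (by rw [hb, a.2])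
  have hk' : ν'.hom k = A'.mark := l'.emb.hom_injective <| calc
    l'.emb.hom (ν'.hom k) = l.emb.hom (ν.hom k) :=
      (DFunLike.congr_fun (congrArg Embedding.hom hl) k).symm
    _ = l'.emb.hom A'.mark := by rw [hk, l.hom_mark, l'.hom_mark]
  let νk : (⟨B, k⟩ : MarkedChart.{u, v} n X) ⟶ A := ⟨ν, hk⟩
  have hkb : k • b = b := (MarkedChart.smul_iff νk b).1 (hb ▸ a.2)
  exact (mk_eq_mk_iff (V := R.marked)).2 ⟨⟨B, k⟩, νk, ⟨ν', hk'⟩, ⟨b, hkb⟩, Subtype.ext hb,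
    Subtype.ext hb', MarkedChart.Hom.ext hl, MarkedChart.Hom.ext hr⟩

theorem isOpenMap_sectorIncl_arr : IsOpenMap (sectorIncl R).arr := by
  refine SpanArr.isOpenMap_of_mk ?_
  rintro ⟨i, j, A, l, r⟩ U hU
  obtain ⟨N, hN, rfl⟩ := isOpen_induced_iff.1 hU
  have h_sector (i) : IsOpen ((sectorIncl R).obj '' Set.range (Sigma.mk i)) :=
    (isOpenEmbedding_sectorIncl_obj R).isOpenMap _ isOpen_range_sigmaMk
  have h_mid := isOpenMap_mk (V := O.chart) ⟨i.1, j.1, A.chart, l.emb, r.emb⟩ N hN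
  -- Between the sectors of `i` and `j`, the image is detected on the underlying arrows of `𝖷`.
  have h_open := ((h_sector i).preimage O.groupoid.inertia.continuous_src).inter
    ((h_mid.preimage O.groupoid.continuous_inertia_arr).inter
      ((h_sector j).preimage O.groupoid.inertia.continuous_tgt))
  refine (congrArg IsOpen (Set.Subset.antisymm ?_ ?_)).mpr h_open
  · rintro _ ⟨a, ha, rfl⟩
    exact ⟨⟨_, ⟨_, rfl⟩, rfl⟩, ⟨a.1, ha, rfl⟩, ⟨_, ⟨_, rfl⟩, rfl⟩⟩
  · rintro ⟨⟨_, _, _⟩, hsrc, htgt, _⟩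
      ⟨⟨_, ⟨x, rfl⟩, rfl⟩, ⟨(b : A.chart.V), hb, rfl⟩, ⟨_, ⟨y, rfl⟩, rfl⟩⟩
    have hx : l.emb.toFun b = x.1 :=
      (sigma_mk_injective (β := fun p => (O.chart p).V) hsrc).symm.trans x.2
    have hy : r.emb.toFun b = y.1 := sigma_mk_injective (β := fun p => (O.chart p).V) htgt
    have hkb : A.mark • b = b := (MarkedChart.smul_iff l b).1 (hx ▸ x.2)
    obtain rfl : MarkedChart.sectorMap l ⟨b, hkb⟩ = x := Subtype.ext hx
    obtain rfl : MarkedChart.sectorMap r ⟨b, hkb⟩ = y := Subtype.ext hy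
    exact ⟨⟨b, hkb⟩, hb, rfl⟩

theorem isOpenEmbedding_sectorIncl_arr : IsOpenEmbedding (sectorIncl R).arr :=
  .of_continuous_injective_isOpenMap (sectorIncl R).continuous_arr
    (sectorIncl_arr_injective R) (isOpenMap_sectorIncl_arr R)

theorem isFullyFaithful_sectorIncl : (sectorIncl R).IsFullyFaithful :=
  .of_isEmbedding (isOpenEmbedding_sectorIncl_obj R).injective
    (isOpenEmbedding_sectorIncl_arr R).isEmbedding (sectorIncl_full R)

theorem exists_conj_rep (p : X) (g : (O.chart p).G) :
    ∃ z, z * g * z⁻¹ = R.rep p (ConjClasses.mk g) :=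
  isConj_iff.1 (ConjClasses.mk_eq_mk_iff_isConj.1 (R.mk_rep p _).symm)

/-- An element conjugating `g` to the representative of its class. -/
noncomputable def conjRep (p : X) (g : (O.chart p).G) : (O.chart p).G :=
  (exists_conj_rep R p g).choose

theorem conjRep_spec (p : X) (g : (O.chart p).G) :
    conjRep R p g * g * (conjRep R p g)⁻¹ = R.rep p (ConjClasses.mk g) :=
  (exists_conj_rep R p g).choose_spec

/-- The translation `V_p^g → V_p^h` onto the sector of the representative `h` of the class
of `g`. -/
noncomputable def conjHom (p : X) (g : (O.chart p).G) :
    (⟨O.chart p, g⟩ : MarkedChart.{u, v} n X) ⟶ R.marked ⟨p, ConjClasses.mk g⟩ :=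
  ⟨(O.chart p).translate (conjRep R p g), conjRep_spec R p g⟩

/-- The map `⊔_g V_p^g → ⊔_{(g)} V_p^g` which underlies the retraction `M` of the inertia groupoid
onto the twisted sectors. -/
noncomputable def fixedRetract : O.FixedPt → (twistedSectors R).Obj :=
  Sigma.map (fun j => ⟨j.1, ConjClasses.mk j.2⟩) fun j => MarkedChart.sectorMap (conjHom R j.1 j.2)

theorem continuous_fixedRetract : Continuous (fixedRetract R) :=
  Continuous.sigma_map fun j =>
    (MarkedChart.isOpenEmbedding_sectorMap (conjHom R j.1 j.2)).continuous

theorem isOpenMap_fixedRetract : IsOpenMap (fixedRetract R) :=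
  isOpenMap_sigma_map.2 fun j =>
    (MarkedChart.isOpenEmbedding_sectorMap (conjHom R j.1 j.2)).isOpenMap

/-- The arrow of the inertia groupoid from the loop of a fixed point to its retraction. -/
noncomputable def retractArrow (d : O.FixedPt) : O.groupoid.inertia.Arr :=
  ⟨(O.loopOfFixed d, Quot.mk _ ⟨⟨d.1.1, d.1.1, O.chart d.1.1, 𝟙 _,
      (O.chart d.1.1).translate (conjRep R d.1.1 d.1.2)⟩, d.2.1⟩,
      (sectorIncl R).obj (fixedRetract R d)),
    (O.fixedLoop_conj_iff (𝟙 _) ((O.chart d.1.1).translate (conjRep R d.1.1 d.1.2)) d.2.1 d.2.2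
      (fixedRetract R d).2.2).2 ⟨d.1.2, rfl, conjRep_spec R d.1.1 d.1.2⟩⟩

theorem continuous_retractArrow : Continuous (retractArrow R) :=
  Continuous.subtype_mk (O.continuous_loopOfFixed.prodMk (Continuous.prodMk
    (continuous_sigma fun j => (continuous_mk (V := O.chart) ⟨j.1, j.1, O.chart j.1, 𝟙 _,
      (O.chart j.1).translate (conjRep R j.1 j.2)⟩).comp continuous_subtype_val)
    ((sectorIncl R).continuous_obj.comp (continuous_fixedRetract R)))) _

theorem exists_isMorita_inertia_twistedSectors :
    ∃ M : TopGroupoid.Hom O.groupoid.inertia (twistedSectors R), M.IsMorita :=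
  have h_cont := O.loopHomeomorph.symm.continuous
  (isFullyFaithful_sectorIncl R).exists_isMorita_of_deformation SpanArr.isOpenMap_src
    ((continuous_retractArrow R).comp h_cont) O.loopHomeomorph.apply_symm_apply
    ((continuous_fixedRetract R).comp h_cont)
    ((isOpenMap_fixedRetract R).comp O.loopHomeomorph.symm.isOpenMap) fun _ => rfl

theorem sectorArrow_injective (p : X) : Function.Injective (sectorArrow R p) := by
  rintro ⟨⟨c, z⟩, x⟩ ⟨⟨d, z'⟩, y⟩ e
  have hsrc : (⟨⟨p, c⟩, x⟩ : Σ i, (R.marked i).Sector) = ⟨⟨p, d⟩, y⟩ :=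
    congrArg (twistedSectors R).src e
  cases hsrc
  obtain rfl : z = z' := Subtype.ext <|
    (O.mk_translate_eq_iff (l := 𝟙 _) (r := 𝟙 _) (a := x.1)).1 <| by
      rw [Category.id_comp, Category.id_comp]
      exact congrArg (sectorForget R) e
  rfl

theorem isOpenEmbedding_sectorArrow (p : X) : IsOpenEmbedding (sectorArrow R p) :=
  .of_continuous_injective_isOpenMap
    (continuous_sigma fun j => continuous_mk (V := R.marked) ⟨⟨p, j.1⟩, ⟨p, j.1⟩,
      R.marked ⟨p, j.1⟩, 𝟙 _, (R.marked ⟨p, j.1⟩).translate j.2⟩)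
    (sectorArrow_injective R p)
    (isOpenMap_sigma.2 fun j => isOpenMap_mk (V := R.marked) ⟨⟨p, j.1⟩, ⟨p, j.1⟩,
      R.marked ⟨p, j.1⟩, 𝟙 _, (R.marked ⟨p, j.1⟩).translate j.2⟩)

variable {R} in
theorem conjClass_eq_of_hom {p : X} {c d : ConjClasses (O.chart p).G} {A : MarkedChart.{u, v} n X}
    (l : A ⟶ R.marked ⟨p, c⟩) (r : A ⟶ R.marked ⟨p, d⟩) : c = d := by
  obtain ⟨(z : (O.chart p).G), hz⟩ := Embedding.exists_comp_translate l.emb r.emb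
  rw [← R.mk_rep p c, ← R.mk_rep p d, ConjClasses.mk_eq_mk_iff_isConj]
  refine isConj_iff.2 ⟨z, ?_⟩
  calc
    z * R.rep p c * z⁻¹ = (l.emb ≫ (O.chart p).translate z).hom A.mark :=
      congrArg (fun g : (O.chart p).G => z * g * z⁻¹) l.hom_mark.symm
    _ = R.rep p d := (DFunLike.congr_fun (congrArg Embedding.hom hz) A.mark).trans r.hom_mark

theorem range_sectorArrow (p : X) : Set.range (sectorArrow R p) =
    {a | ((twistedSectors R).src a).1.1 = p ∧ ((twistedSectors R).tgt a).1.1 = p} := by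
  refine Set.Subset.antisymm ?_ ?_
  · rintro _ ⟨a, rfl⟩
    exact ⟨rfl, rfl⟩
  · rintro ⟨⟨⟨q, c⟩, ⟨q', d⟩, A, l, r⟩, a⟩ ⟨hsrc, htgt⟩
    obtain rfl : q = p := hsrc
    obtain rfl : q' = q := htgt
    obtain rfl := conjClass_eq_of_hom l r
    obtain ⟨z, rfl⟩ := MarkedChart.Hom.exists_comp_translate l r
    exact ⟨⟨⟨c, z⟩, MarkedChart.sectorMap l a⟩, (mk_comp_right (V := R.marked) l _ a).symm⟩

end Orbifold

open TopGroupoid in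
theorem mainTheorem12_general (n : ℕ) (X : Type v) [TopologicalSpace X]
    (O : Orbifold.{u, v} n X) (R : O.Representatives) :
    MoritaEquivalent O.groupoid.inertia (Orbifold.twistedSectors R) ∧
    (∃ (ι : Hom (Orbifold.twistedSectors R) O.groupoid.inertia)
        (M : Hom O.groupoid.inertia (Orbifold.twistedSectors R)),
      ι.IsSubgroupoidEmbedding ∧
      (∀ (p : X) (c : ConjClasses (O.chart p).G) (x : (R.marked ⟨p, c⟩).Sector),
        ι.obj ⟨⟨p, c⟩, x⟩ = O.fixedLoop p (R.rep p c) x.1 x.2) ∧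
      (∀ T : ChartCat.Triple R.marked,
        (ι.arr (Quot.mk _ T)).1.2.1 = Quot.mk _ (Orbifold.forgetMark R T)) ∧
      M.IsMorita) ∧
    (∀ p : X, IsOpenEmbedding (Orbifold.sectorArrow R p) ∧
      Set.range (Orbifold.sectorArrow R p) =
        {a | ((Orbifold.twistedSectors R).src a).1.1 = p ∧
          ((Orbifold.twistedSectors R).tgt a).1.1 = p}) := by
  obtain ⟨M, hM⟩ := Orbifold.exists_isMorita_inertia_twistedSectors R
  have h_equiv : MoritaEquivalent O.groupoid.inertia (Orbifold.twistedSectors R) :=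
    Hom.IsMorita.moritaEquivalent.{max (u + 1) v, max (u + 1) v, max u v, max (u + 1) v} hM
  refine ⟨h_equiv, ⟨Orbifold.sectorIncl R, M, ?_, fun _ _ _ => rfl, fun _ => rfl, hM⟩,
    fun p => ⟨Orbifold.isOpenEmbedding_sectorArrow R p, Orbifold.range_sectorArrow R p⟩⟩
  exact ⟨(Orbifold.isOpenEmbedding_sectorIncl_obj R).isEmbedding,
    (Orbifold.isOpenEmbedding_sectorIncl_arr R).isEmbedding⟩

open TopGroupoid in
theorem mainTheorem12 (n : ℕ) (X : Type v) [TopologicalSpace X] [T2Space X] [ParacompactSpace X]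
    (O : Orbifold.{u, v} n X) (R : O.Representatives) :
    -- the inertia groupoid is Morita equivalent to the twisted sectors
    MoritaEquivalent O.groupoid.inertia (Orbifold.twistedSectors R) ∧
    -- the twisted sectors are a subgroupoid of the inertia groupoid, via
    -- `(x, g) ↦ [id, x, λ_g]` on objects and `[λ₁, w, λ₂] ↦ [λ₁, w, λ₂]` on arrows,
    -- and the inertia groupoid has a Morita morphism to them
    (∃ (ι : Hom (Orbifold.twistedSectors R) O.groupoid.inertia)
        (M : Hom O.groupoid.inertia (Orbifold.twistedSectors R)),
      ι.IsSubgroupoidEmbedding ∧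
      (∀ (p : X) (c : ConjClasses (O.chart p).G) (x : (R.marked ⟨p, c⟩).Sector),
        ι.obj ⟨⟨p, c⟩, x⟩ = O.fixedLoop p (R.rep p c) x.1 x.2) ∧
      (∀ T : ChartCat.Triple R.marked,
        (ι.arr (Quot.mk _ T)).1.2.1 = Quot.mk _ (Orbifold.forgetMark R T)) ∧
      M.IsMorita) ∧
    -- over each chart `V_p` the twisted sectors are `⊔_{(g)} V_p^g × C(g) ⇉ ⊔_{(g)} V_p^g`
    (∀ p : X, IsOpenEmbedding (Orbifold.sectorArrow R p) ∧
      Set.range (Orbifold.sectorArrow R p) =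
        {a | ((Orbifold.twistedSectors R).src a).1.1 = p ∧
          ((Orbifold.twistedSectors R).tgt a).1.1 = p}) :=
  mainTheorem12_general n X O R
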